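/- **Theorem 5.** Let $G$ be a finite simple graph with non-negative real edge weights. The length of a path is the sum of the weights of its edges, and $\mathrm{dist}_G(u,v)$ is the minimum length of a path from $u$ to $v$ ($\infty$ if there is none). The weak diameter of $A\subseteq V(G)$ is $\sup_{u,v\in A}\mathrm{dist}_G(u,v)$. For a partition $\mathcal P$ of $V(G)$ into nonempty parts, a total order $\preceq$ on $\mathcal P$ and a real $r>0$, a part $Y$ is weakly $r$-reachable from a part $X$ if there is a path of length at most $r$ from a vertex of $X$ to a vertex of $Y$ in $G\bigl[\bigcup\{Z\in\mathcal P : Y\preceq Z\}\bigr]$, and $\mathrm{wcol}_r(G,\mathcal P,\preceq)$ is the maximum over $X\in\mathcal P$ of the number of parts that are weakly $r$-reachable from $X$ (and $0$ if $V(G)=\emptyset$). A tree decomposition of $G$ is a pair $(T,\beta)$ of a finite tree $T$ and sets $\beta(t)\subseteq V(G)$, $t\in V(T)$, called bags, such that for every $v\in V(G)$ the nodes $t$ with $v\in\beta(t)$ induce a nonempty connected subgraph of $T$, and every edge of $G$ has both its endpoints in some bag. There is an algorithm that, given an edge-weighted graph $G$, a real $\rho>0$ and a tree decomposition $(T,\beta)$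 of $G$, computes in time polynomial in $|V(G)|+|V(T)|$ (on a random access machine that adds, subtracts and compares integers and real numbers in unit time) a partition $\mathcal P$ of $V(G)$ into sets of weak diameter at most $\rho$ and a total order $\preceq$ on $\mathcal P$ such that, for every $k$ that bounds the size of all bags and for every real $r>\rho$, \[ \mathrm{wcol}_r(G,\mathcal P,\preceq)\le\min\left(k\cdot 2^k\cdot\binom{k+\left\lceil 2\frac r\rho\right\rceil}{k},\ \left(2\lceil 2r/\rho\rceil+k+1\right)^{3\lceil 2r/\rho\rceil+4}\right). \] -/

import Mathlib

open scoped NNReal ENNReal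

noncomputable section

/-! ### Edge-weighted graphs, distances, tree decompositions -/

/-- A simple graph whose edges carry non-negative real weights
(the values of `weight` on pairs that are not edges are irrelevant). -/
structure EdgeWeightedGraph (V : Type*) where
  graph : SimpleGraph V
  weight : Sym2 V → ℝ≥0

namespace EdgeWeightedGraph

variable {V : Type*} (G : EdgeWeightedGraph V)

/-- The length of a walk: the sum of the weights of its edges. -/
def length {u v : V} (p : G.graph.Walk u v) : ℝ≥0 := (p.edges.map G.weight).sum

/-- The distance of two vertices (infinite if no walk joins them). -/
def dist (u v : V) : ℝ≥0∞ := ⨅ p : G.graph.Walk u v, (G.length p : ℝ≥0∞)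

/-- The weak diameter of a set of vertices: distances are measured in the whole graph. -/
def weakDiam (A : Set V) : ℝ≥0∞ := ⨆ u ∈ A, ⨆ v ∈ A, G.dist u v

variable [Fintype V] [DecidableEq V]

/-- The parts `Y` that are weakly `r`-reachable from the part `X`: some path of length at most `r`
from a vertex of `X` to a vertex of `Y` only uses vertices of the parts `Z` with `Y ≼ Z`. -/
def wreach (r : ℝ) (P : Finpartition (Finset.univ : Finset V)) (le : P.parts → P.parts → Prop)
    (X : P.parts) : Set P.parts :=
  {Y | ∃ x ∈ X.1, ∃ y ∈ Y.1, ∃ p : G.graph.Walk x y,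
    p.IsPath ∧ (G.length p : ℝ) ≤ r ∧ ∀ z ∈ p.support, ∃ Z : P.parts, le Y Z ∧ z ∈ Z.1}

/-- The weak `r`-coloring number: the maximum of `|wreach X|` over all parts `X`
(and `0` if there are no parts). -/
def wcol (r : ℝ) (P : Finpartition (Finset.univ : Finset V)) (le : P.parts → P.parts → Prop) : ℕ :=
  P.parts.attach.sup fun X => (G.wreach r P le X).ncard

end EdgeWeightedGraph

/-- `(T, bag)` is a tree decomposition of the graph `G`. -/
structure IsTreeDecomposition {V I : Type*} (G : SimpleGraph V) (T : SimpleGraph I)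
    (bag : I → Finset V) : Prop where
  tree : T.IsTree
  /-- Connected graphs are nonempty. -/
  connected : ∀ v : V, (T.induce {t | v ∈ bag t}).Connected
  edge : ∀ u v : V, G.Adj u v → ∃ t, u ∈ bag t ∧ v ∈ bag t

/-! ### A machine model with a step count

A random access machine with structured control flow. It has natural number cells and real number
cells, both arranged in two-dimensional arrays; a program mentions finitely many arrays by name, and
computes the indices. The only arithmetic is addition and subtraction (truncated on the naturals),
the only tests are comparisons, and a program holds no real constants. Hence in `t` steps a bit
length grows by at most `O(t)`, so that counting each operation as one step is legitimate. -/

/-- The contents of all cells: `nat a i j` is the cell `(i, j)` of the `a`-th array. -/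
structure Memory where
  nat : ℕ → ℕ → ℕ → ℕ
  real : ℕ → ℕ → ℕ → ℝ

inductive NatExpr where
  | const (c : ℕ)
  | get (a : ℕ) (i j : NatExpr)
  | add (e f : NatExpr)
  | sub (e f : NatExpr)

inductive RealExpr where
  | get (a : ℕ) (i j : NatExpr)
  | add (e f : RealExpr)
  | sub (e f : RealExpr)

inductive Test where
  | natLE (e f : NatExpr)
  | realLE (e f : RealExpr)
  | not (b : Test)
  | and (b c : Test)

inductive Program where
  | skip
  | setNat (a : ℕ) (i j : NatExpr) (e : NatExpr)
  | setReal (a : ℕ) (i j : NatExpr) (e : RealExpr)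
  | seq (p q : Program)
  | ite (b : Test) (p q : Program)
  | while (b : Test) (p : Program)

def NatExpr.eval (s : Memory) : NatExpr → ℕ
  | const c => c
  | get a i j => s.nat a (i.eval s) (j.eval s)
  | add e f => e.eval s + f.eval s
  | sub e f => e.eval s - f.eval s

def RealExpr.eval (s : Memory) : RealExpr → ℝ
  | get a i j => s.real a (i.eval s) (j.eval s)
  | add e f => e.eval s + f.eval s
  | sub e f => e.eval s - f.eval s

def Test.Holds (s : Memory) : Test → Prop
  | natLE e f => e.eval s ≤ f.eval s
  | realLE e f => e.eval s ≤ f.eval s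
  | not b => ¬ b.Holds s
  | and b c => b.Holds s ∧ c.Holds s

/-- Write `x` into the cell `(i, j)` of an array collection at array `a`. -/
def updateCell {α : Type} (m : ℕ → ℕ → ℕ → α) (a i j : ℕ) (x : α) : ℕ → ℕ → ℕ → α :=
  fun a' i' j' => if a' = a ∧ i' = i ∧ j' = j then x else m a' i' j'

/-- `Exec p s s' t`: the program `p`, started with memory `s`, halts after `t` steps with
memory `s'`. Every assignment, every `skip` and every evaluation of a test is one step. -/
inductive Exec : Program → Memory → Memory → ℕ → Prop
  | skip (s : Memory) : Exec .skip s s 1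
  | setNat (s : Memory) (a : ℕ) (i j e : NatExpr) :
      Exec (.setNat a i j e) s
        { s with nat := updateCell s.nat a (i.eval s) (j.eval s) (e.eval s) } 1
  | setReal (s : Memory) (a : ℕ) (i j : NatExpr) (e : RealExpr) :
      Exec (.setReal a i j e) s
        { s with real := updateCell s.real a (i.eval s) (j.eval s) (e.eval s) } 1
  | seq {p q : Program} {s s' s'' : Memory} {t t' : ℕ} :
      Exec p s s' t → Exec q s' s'' t' → Exec (.seq p q) s s'' (t + t')
  | iteTrue {b : Test} {p q : Program} {s s' : Memory} {t : ℕ} :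
      b.Holds s → Exec p s s' t → Exec (.ite b p q) s s' (t + 1)
  | iteFalse {b : Test} {p q : Program} {s s' : Memory} {t : ℕ} :
      ¬ b.Holds s → Exec q s s' t → Exec (.ite b p q) s s' (t + 1)
  | whileTrue {b : Test} {p : Program} {s s' s'' : Memory} {t t' : ℕ} :
      b.Holds s → Exec p s s' t → Exec (.while b p) s' s'' t' →
        Exec (.while b p) s s'' (t + t' + 1)
  | whileFalse {b : Test} {p : Program} {s : Memory} :
      ¬ b.Holds s → Exec (.while b p) s s 1

/-! ### Input and output of the algorithm -/

/-- The value `f i j` for `i < n` and `j < m`, and `0` elsewhere. -/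
def tableEntry {α : Type} [Zero α] {n m : ℕ} (f : Fin n → Fin m → α) (i j : ℕ) : α :=
  if h : i < n ∧ j < m then f ⟨i, h.1⟩ ⟨j, h.2⟩ else 0

open Classical in
/-- The initial memory for an edge-weighted graph `G` on `n` vertices, a tree `T` on `m` nodes,
bags `bag` and a real `ρ`. Natural number arrays: the array `0` starts with `n` and `m`, the
arrays `1`, `2`, `3` are the adjacency matrices of `G` and of `T` and the incidence matrix of nodes
and bag members. Real arrays: the array `0` is the matrix of edge weights, the array `1` starts
with `ρ`. All other cells are `0`. -/
def inputMemory {n m : ℕ} (G : EdgeWeightedGraph (Fin n)) (T : SimpleGraph (Fin m))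
    (bag : Fin m → Finset (Fin n)) (ρ : ℝ) : Memory where
  nat
    | 0, 0, 0 => n
    | 0, 0, 1 => m
    | 1, i, j => tableEntry (fun u v => if G.graph.Adj u v then 1 else 0) i j
    | 2, i, j => tableEntry (fun s t => if T.Adj s t then 1 else 0) i j
    | 3, i, j => tableEntry (fun t v => if v ∈ bag t then 1 else 0) i j
    | _, _, _ => 0
  real
    | 0, i, j => tableEntry (fun u v => if G.graph.Adj u v then (G.weight s(u, v) : ℝ) else 0) i j
    | 1, 0, 0 => ρ
    | _, _, _ => 0

/-- The memory `s` describes the partition `P` and the order `le` on its parts: the cells `(v, 0)`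
of the natural number array `4` label the vertices such that two vertices have the same label
exactly if they are in the same part, and the parts are ordered as their labels. -/
def Describes {n : ℕ} (s : Memory) (P : Finpartition (Finset.univ : Finset (Fin n)))
    (le : P.parts → P.parts → Prop) : Prop :=
  ∀ X Y : P.parts, ∀ u ∈ X.1, ∀ v ∈ Y.1, (le X Y ↔ s.nat 4 u 0 ≤ s.nat 4 v 0)

end

/-! Let `h = ρ / 2` and treat the bags in the order of a search of the tree. Round `j` works with
the uncovered vertices at distance at most `h` from its bag: it covers those that are connected,
through such vertices, to an uncovered vertex of the bag. What a round covers is split according to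
a bag vertex at distance at most `h`. This gives at most `k` parts per round, each of weak diameter
at most `2 * h = ρ`; they are ordered by round, then by that bag vertex.

Fix a part covered in round `last`. A part that is weakly reachable from it comes from round `last`,
or from an earlier round `j` that is relevant: from just outside the set of round `j` a walk leads
to the set of round `last` through vertices covered after `j`, of length at most `L * h` with `L =
⌈2 * r / ρ⌉₊`. Round `j` has level `a` if the length is at most `a * h`. It remains to count the
rounds of level `L`.

Two facts enter. The bag of a relevant round separates the set of round `last` from all earlier bags
(`mem_below_of_reaches`, `exists_mem_bag`). And a neighbour of a covered set that the round left
uncovered is farther than `h` from the bag (`BagCovering.far`). Together they give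
`BagCovering.persist`: after a round `q` of level `a + 1`, and up to `e` if no round of level `a`
intervenes, the relevant bags all meet the set of `q`, and from some point on that of a second round
`i` of level `a + 1`. But a bag meets at most `k` sets.

`EventSystem` keeps only this combinatorics. Recursion on the number of sets known to meet all bags
of an interval gives the binomial bound; counting, level by level, the new events between
consecutive old ones gives the power.

For the algorithm, `Runs` is a total correctness triple with a step bound. The program tabulates
distances truncated at `ρ` and then performs the rounds under the invariant `CoverState`, whose
machine-free core is `PartialCovering` and `PartialSearch`. -/

/-! ### Counting events of bounded level -/

/-- An abstract record of the events that are relevant for a fixed later event `last`: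
`Lvl a j` says that event `j` is at most `a` units away, `Meets i j` that the set covered by event
`i` meets the bag of event `j`. -/
structure EventSystem (k L last : ℕ) (Meets Lvl : ℕ → ℕ → Prop) : Prop where
  card_le : ∀ (j : ℕ) (S : Finset ℕ), (∀ i ∈ S, Meets i j) → S.card ≤ k
  meets_self : ∀ a j, Lvl a j → Meets j j
  mono : ∀ a b j, a ≤ b → Lvl a j → Lvl b j
  not_zero : ∀ j, ¬ Lvl 0 j
  persist : ∀ a q e, Lvl (a + 1) q → q < e → e ≤ last → (∀ j, q < j → j < e → ¬ Lvl a j) →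
    ∃ i e', q ≤ i ∧ i < e' ∧ e' ≤ e ∧ Lvl (a + 1) i ∧
      (∀ j, Lvl L j → q < j → j < e' → Meets q j) ∧
      (∀ j, Lvl L j → e' ≤ j → j < e → Meets i j)

namespace EventSystem

variable {k L last : ℕ} {Meets Lvl : ℕ → ℕ → Prop}

-- Induction on the free places `t` of a bag, then on the number `l` of levels above `a`. The sets
-- of the events in `I` meet every relevant bag of the interval. If `t = 0`, a relevant bag would
-- meet the `k` sets of `I` and its own. Otherwise the first event of level `a + 1` cuts the
-- interval into a piece with one level fewer and two pieces in which `persist` adds a member to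
-- `I`.
open Classical in
theorem two_mul_card_interval_add_one_le (E : EventSystem k L last Meets Lvl) (t : ℕ) :
    ∀ (l a s e : ℕ) (I : Finset ℕ), a + l = L → I.card + t = k → e ≤ last →
      (∀ i ∈ I, i < s) → (∀ i ∈ I, ∀ j, s ≤ j → j < e → Lvl L j → Meets i j) →
      (∀ j, s ≤ j → j < e → ¬ Lvl a j) →
      2 * ((Finset.Ico s e).filter (Lvl L)).card + 1 ≤ 2 ^ t * (l + t).choose t := by
  induction t with
  | zero =>
    intro l a s e I hal hI he hIs hM hlow
    have : (Finset.Ico s e).filter (Lvl L) = ∅ := by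
      refine Finset.filter_eq_empty_iff.2 fun j hj hLj => ?_
      rw [Finset.mem_Ico] at hj
      have h1 := E.card_le j (insert j I) (by
        intro i hi
        rcases Finset.mem_insert.1 hi with rfl | hi
        · exact E.meets_self _ _ hLj
        · exact hM i hi j hj.1 hj.2 hLj)
      rw [Finset.card_insert_of_notMem (fun h => absurd (hIs j h) (by omega))] at h1
      omega
    simp [this]
  | succ t iht =>
    intro l
    induction l with
    | zero =>
      intro a s e I hal hI he hIs hM hlow
      have : (Finset.Ico s e).filter (Lvl L) = ∅ := by
        refine Finset.filter_eq_empty_iff.2 fun j hj hLj => ?_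
        rw [Finset.mem_Ico] at hj
        obtain rfl : a = L := by omega
        exact hlow j hj.1 hj.2 hLj
      rw [this]
      simpa using Nat.one_le_two_pow
    | succ l ihl =>
      intro a s e I hal hI he hIs hM hlow
      -- Pascal's rule is the recursion: one piece with `l` lowered, two pieces with `t` lowered.
      have pascal : 2 ^ (t + 1) * (l + 1 + (t + 1)).choose (t + 1) =
          2 ^ (t + 1) * (l + (t + 1)).choose (t + 1) + 2 * (2 ^ t * (l + 1 + t).choose t) := by
        have : l + 1 + (t + 1) = (l + 1 + t) + 1 := by ring
        rw [this, Nat.choose_succ_succ, show l + (t + 1) = l + 1 + t by ring]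
        ring
      by_cases hex : ∃ q, s ≤ q ∧ q < e ∧ Lvl (a + 1) q
      · obtain ⟨q, ⟨hsq, hqe, hq⟩, hmin⟩ : ∃ q, (s ≤ q ∧ q < e ∧ Lvl (a + 1) q) ∧
            ∀ j < q, ¬ (s ≤ j ∧ j < e ∧ Lvl (a + 1) j) :=
          ⟨Nat.find hex, Nat.find_spec hex, fun j hj => Nat.find_min hex hj⟩
        obtain ⟨i, e', hqi, hie, hee, -, h1, h2⟩ := E.persist a q e hq hqe he
          fun j hqj hje => hlow j (by omega) hje
        have c1 := ihl (a + 1) s q I (by omega) hI (by omega) hIs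
          (fun i hi j hsj hjq => hM i hi j hsj (by omega))
          (fun j hsj hjq h => hmin j hjq ⟨hsj, by omega, h⟩)
        have c2 := iht (l + 1) a (q + 1) e' (insert q I) hal
          (by rw [Finset.card_insert_of_notMem (fun h => absurd (hIs q h) (by omega))]; omega)
          (by omega)
          (fun i hi => by
            rcases Finset.mem_insert.1 hi with rfl | hi
            · omega
            · exact (hIs i hi).trans (by omega))
          (fun i hi j hqj hje hj => by
            rcases Finset.mem_insert.1 hi with rfl | hi
            · exact h1 j hj (by omega) hje
            · exact hM i hi j (by omega) (by omega) hj)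
          (fun j hqj hje => hlow j (by omega) (by omega))
        have c3 := iht (l + 1) a e' e (insert i I) hal
          (by rw [Finset.card_insert_of_notMem (fun h => absurd (hIs i h) (by omega))]; omega)
          he
          (fun i' hi => by
            rcases Finset.mem_insert.1 hi with rfl | hi
            · omega
            · exact (hIs i' hi).trans (by omega))
          (fun i' hi j hqj hje hj => by
            rcases Finset.mem_insert.1 hi with rfl | hi
            · exact h2 j hj (by omega) hje
            · exact hM i' hi j (by omega) (by omega) hj)
          (fun j hqj hje => hlow j (by omega) (by omega))
        have hsplit : (Finset.Ico s e).filter (Lvl L) ⊆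
            (((Finset.Ico s q).filter (Lvl L) ∪ {q}) ∪ (Finset.Ico (q + 1) e').filter (Lvl L)) ∪
              (Finset.Ico e' e).filter (Lvl L) := by
          intro j hj
          simp only [Finset.mem_union, Finset.mem_filter, Finset.mem_Ico,
            Finset.mem_singleton] at hj ⊢
          rcases lt_trichotomy j q with h | h | h
          · exact Or.inl (Or.inl (Or.inl ⟨⟨hj.1.1, h⟩, hj.2⟩))
          · exact Or.inl (Or.inl (Or.inr h))
          · rcases lt_or_ge j e' with h' | h'
            · exact Or.inl (Or.inr ⟨⟨h, h'⟩, hj.2⟩)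
            · exact Or.inr ⟨⟨h', hj.1.2⟩, hj.2⟩
        -- With counts `x, y, z` in the pieces, `2 * (x + 1 + y + z) + 1` is the sum of `2 * x + 1`,
        -- `2 * y + 1` and `2 * z + 1`; hence the form of the bound.
        have := (Finset.card_le_card hsplit).trans ((Finset.card_union_le _ _).trans
          (Nat.add_le_add_right ((Finset.card_union_le _ _).trans
            (Nat.add_le_add_right (Finset.card_union_le _ _) _)) _))
        rw [Finset.card_singleton] at this
        omega
      · have c1 := ihl (a + 1) s e I (by omega) hI he hIs hM
          (fun j hsj hje h => hex ⟨j, hsj, hje, h⟩)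
        omega

open Classical in
/-- Few events are relevant: a bound that is polynomial in `L` for every fixed `k`. -/
theorem two_mul_card_add_one_le (E : EventSystem k L last Meets Lvl) :
    2 * ((Finset.range last).filter (Lvl L)).card + 1 ≤ 2 ^ k * (L + k).choose k := by
  have := E.two_mul_card_interval_add_one_le k L 0 0 last ∅ (by simp) (by simp) le_rfl
    (by simp) (by simp) (fun j _ _ => E.not_zero j)
  rwa [← Finset.range_eq_Ico] at this

-- Let `m` be the last event of `S`. By `persist`, the set of any `q ∈ S` meets the bag of `m`, or
-- it meets the bag of an event whose set meets that of `m`. There are `k` choices for the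
-- intermediate event, and for each of them `k` choices for `q`.
open Classical in
theorem card_gap_le (E : EventSystem k L last Meets Lvl) (a : ℕ) (ha : a + 1 ≤ L) (S : Finset ℕ)
    (hS : ∀ q ∈ S, q < last ∧ Lvl (a + 1) q)
    (hgap : ∀ q ∈ S, ∀ q' ∈ S, ∀ j, q ≤ j → j ≤ q' → ¬ Lvl a j) : S.card ≤ k * k := by
  rcases S.eq_empty_or_nonempty with rfl | hne
  · simp
  set m := S.max' hne with hm
  have hmS : m ∈ S := S.max'_mem hne
  have key : ∀ q ∈ S, ∃ f, Meets f m ∧ Meets q f := by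
    intro q hq
    have hqm : q ≤ m := S.le_max' q hq
    obtain ⟨i, e, hqi, hie, hem, hi, h1, h2⟩ := E.persist a q (m + 1) (hS q hq).2 (by omega)
      (hS m hmS).1 (fun j hqj hjm => hgap q hq m hmS j hqj.le (by omega))
    have hself : Meets q q := E.meets_self _ _ (hS q hq).2
    have hLm : Lvl L m := E.mono _ _ _ ha (hS m hmS).2
    rcases hqm.eq_or_lt with heq | hlt
    · exact ⟨q, heq ▸ hself, hself⟩
    rcases lt_or_ge m e with hme | hme
    · exact ⟨q, h1 m hLm hlt hme, hself⟩
    · refine ⟨i, h2 m hLm hme (by omega), ?_⟩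
      rcases hqi.eq_or_lt with rfl | hlt'
      · exact hself
      · exact h1 i (E.mono _ _ _ ha hi) hlt' hie
  choose! f hfm hqf using key
  calc S.card ≤ k * (S.image f).card :=
        Finset.card_le_mul_card_image S k fun b _ => E.card_le b _ fun q hq => by
          rw [Finset.mem_filter] at hq
          exact hq.2 ▸ hqf q hq.1
    _ ≤ k * k := Nat.mul_le_mul_left k (E.card_le m _ fun b hb => by
          obtain ⟨q, hq, rfl⟩ := Finset.mem_image.1 hb
          exact hfm q hq)

open Classical in
/-- Few events are relevant: a bound that is polynomial in `k` for every fixed `L`. -/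
theorem card_add_one_le_pow (E : EventSystem k L last Meets Lvl) (a : ℕ) (ha : a ≤ L) :
    ((Finset.range last).filter (Lvl a)).card + 1 ≤ (k * k + 1) ^ a := by
  induction a with
  | zero => simp [E.not_zero]
  | succ a ih =>
    set A := (Finset.range last).filter (Lvl a) with hA
    set A' := (Finset.range last).filter (Lvl (a + 1)) with hA'
    have hsdiff : (A' \ A).card ≤ k * k * (A.card + 1) := by
      rw [← Finset.card_range (A.card + 1)]
      -- The gap in which `j` lies is identified by the number of events of level `a` before `j`.
      refine Finset.card_le_mul_card_image_of_maps_to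
        (f := fun j => (A.filter (· < j)).card) (fun j _ => ?_) _ fun b _ => ?_
      · exact Finset.mem_range.2 (Nat.lt_succ_of_le (Finset.card_filter_le _ _))
      · refine E.card_gap_le a ha _ (fun q hq => ?_) fun q hq q' hq' j hj hj' haj => ?_
        · simp only [hA', Finset.mem_filter, Finset.mem_sdiff, Finset.mem_range] at hq
          exact hq.1.1
        · simp only [Finset.mem_filter, Finset.mem_sdiff] at hq hq'
          have hjA : j ∈ A := by
            have := (Finset.mem_filter.1 hq'.1.1).1
            exact Finset.mem_filter.2 ⟨Finset.mem_range.2 (by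
              have := Finset.mem_range.1 this; omega), haj⟩
          have hne : j ≠ q' := fun h => hq'.1.2 (h ▸ hjA)
          have hlt : (A.filter (· < q)).card < (A.filter (· < q')).card := by
            refine Finset.card_lt_card (Finset.ssubset_iff_subset_ne.2
              ⟨fun x hx => ?_, fun h => ?_⟩)
            · simp only [Finset.mem_filter] at hx ⊢
              exact ⟨hx.1, by omega⟩
            · have : j ∈ A.filter (· < q') := Finset.mem_filter.2 ⟨hjA, by omega⟩
              rw [← h, Finset.mem_filter] at this
              omega
          omega
    have hle : A'.card ≤ (A' \ A).card + A.card := by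
      have := Finset.card_le_card (show A' ⊆ (A' \ A) ∪ A by
        intro x hx; by_cases h : x ∈ A <;> simp [hx, h])
      exact this.trans (Finset.card_union_le _ _)
    have h3 := ih (by omega)
    calc A'.card + 1 ≤ (k * k + 1) * (A.card + 1) := by nlinarith
      _ ≤ (k * k + 1) * (k * k + 1) ^ a := Nat.mul_le_mul_left _ h3
      _ = (k * k + 1) ^ (a + 1) := by rw [pow_succ]; ring

end EventSystem

/-! ### Lengths of walks, and cutting walks -/

namespace EdgeWeightedGraph

variable {V : Type*} (G : EdgeWeightedGraph V)

@[simp] theorem length_nil (u : V) : G.length (SimpleGraph.Walk.nil : G.graph.Walk u u) = 0 := rfl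

@[simp] theorem length_cons {u v w : V} (h : G.graph.Adj u v) (p : G.graph.Walk v w) :
    G.length (SimpleGraph.Walk.cons h p) = G.weight s(u, v) + G.length p := by
  simp [length]

@[simp] theorem length_append {u v w : V} (p : G.graph.Walk u v) (q : G.graph.Walk v w) :
    G.length (p.append q) = G.length p + G.length q := by
  simp [length]

@[simp] theorem length_reverse {u v : V} (p : G.graph.Walk u v) :
    G.length p.reverse = G.length p := by
  simp [length]

theorem length_bypass_le [DecidableEq V] {u v : V} (p : G.graph.Walk u v) :
    G.length p.bypass ≤ G.length p :=
  (p.edges_bypass_sublist_edges.map G.weight).sum_le_sum (by simp)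

theorem length_dropUntil_le [DecidableEq V] {u v w : V} (p : G.graph.Walk u v)
    (h : w ∈ p.support) : G.length (p.dropUntil w h) ≤ G.length p := by
  have := congrArg G.length (p.take_spec h)
  rw [length_append] at this
  exact this ▸ le_add_self

end EdgeWeightedGraph

namespace SimpleGraph.Walk

variable {V : Type*} {H : SimpleGraph V}

/-- A walk that leaves a set for good is cut at the last vertex of the set. -/
theorem exists_last_mem {u v : V} (p : H.Walk u v) (Q : V → Prop) (hv : ¬ Q v)
    (hQ : ∃ z ∈ p.support, Q z) :
    ∃ (w w' : V) (q : H.Walk u w) (h : H.Adj w w') (q' : H.Walk w' v),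
      p = q.append (cons h q') ∧ Q w ∧ ∀ z ∈ q'.support, ¬ Q z := by
  induction p with
  | nil =>
    obtain ⟨z, hz, hQz⟩ := hQ
    simp only [support_nil, List.mem_singleton] at hz
    exact absurd (hz ▸ hQz) hv
  | @cons a b c h p ih =>
    by_cases hex : ∃ z ∈ p.support, Q z
    · obtain ⟨w, w', q, h', q', rfl, hw, hq'⟩ := ih hv hex
      exact ⟨w, w', cons h q, h', q', by simp, hw, hq'⟩
    · obtain ⟨z, hz, hQz⟩ := hQ
      rw [support_cons, List.mem_cons] at hz
      push Not at hex
      rcases hz with rfl | hz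
      · exact ⟨z, b, nil, h, p, by simp, hQz, hex⟩
      · exact absurd hQz (hex z hz)

/-- A walk that enters the set `S` does so along an edge. -/
theorem exists_entering_adj {u v : V} (p : H.Walk u v) (S : Set V) (hu : u ∉ S) (hv : v ∈ S) :
    ∃ a ∈ p.support, ∃ b, H.Adj a b ∧ a ∉ S ∧ b ∈ S := by
  obtain ⟨d, hd, h1, h2⟩ := p.exists_boundary_dart Sᶜ hu (by simpa using hv)
  exact ⟨d.fst, p.dart_fst_mem_support_of_mem_darts hd, d.snd, d.adj, h1, by simpa using h2⟩

end SimpleGraph.Walk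

/-! ### Coverings by bags yield event systems -/

/-- The vertices of a graph are covered in rounds: vertex `v` in round `σ v`. In round `j` every
vertex of the bag `B j` is covered that is not covered already, together with everything connected
to it in the uncovered vertices near the bag; `Δ j` is the part of the graph below `B j`. -/
structure BagCovering {V : Type*} (G : EdgeWeightedGraph V) (h : ℝ) (B : ℕ → Finset V)
    (Δ : ℕ → Set V) (σ : V → ℕ) : Prop where
  pos : 0 < h
  covered : ∀ j, ∀ v ∈ B j, σ v ≤ j
  connected : ∀ v, ∃ c ∈ B (σ v), ∃ p : G.graph.Walk c v, ∀ z ∈ p.support, σ z = σ v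
  far : ∀ w w', G.graph.Adj w w' → σ w < σ w' → ∀ b ∈ B (σ w), ∀ p : G.graph.Walk b w',
    h < G.length p
  mem_below : ∀ j, ∀ c ∈ B j, (∀ i < j, c ∉ B i) → c ∈ Δ j
  notMem_of_mem_below : ∀ j, ∀ v ∈ Δ j, ∀ i < j, v ∉ B i
  boundary : ∀ j a b, G.graph.Adj a b → b ∈ Δ j → a ∉ Δ j → a ∈ B j ∧ ∃ i < j, a ∈ B i
  below_subset : ∀ i j, i < j → ∀ c ∈ B j, (∀ i < j, c ∉ B i) → c ∈ Δ i → Δ j ⊆ Δ i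

namespace BagCovering

variable {V : Type*} {G : EdgeWeightedGraph V} {h : ℝ} {B : ℕ → Finset V} {Δ : ℕ → Set V}
  {σ : V → ℕ}

/-- Just outside the set covered in round `j`, a walk starts that ends in the set covered in round
`last`, that uses only vertices covered after round `j`, and whose length is at most `s`. -/
def Reaches (G : EdgeWeightedGraph V) (σ : V → ℕ) (last : ℕ) (s : ℝ) (j : ℕ) : Prop :=
  ∃ (w w' x : V) (_ : G.graph.Adj w w') (P : G.graph.Walk w' x), σ w = j ∧ σ x = last ∧
    (∀ z ∈ P.support, j < σ z) ∧ (G.length P : ℝ) ≤ s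

theorem notMem_of_lt (C : BagCovering G h B Δ σ) {v : V} {i : ℕ} (hi : i < σ v) : v ∉ B i :=
  fun hv => absurd (C.covered i v hv) (by omega)

/-- The vertex `c` is covered in the same round as `v`, so no earlier bag contains it; this puts it
below its bag. -/
theorem exists_source (C : BagCovering G h B Δ σ) (v : V) :
    ∃ c ∈ B (σ v), c ∈ Δ (σ v) ∧ σ c = σ v ∧
      ∃ p : G.graph.Walk c v, ∀ z ∈ p.support, σ z = σ v := by
  obtain ⟨c, hc, p, hp⟩ := C.connected v
  have hσ : σ c = σ v := hp c p.start_mem_support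
  exact ⟨c, hc, C.mem_below _ c hc (fun i hi => C.notMem_of_lt (hσ ▸ hi)), hσ, p, hp⟩

/-- Walks through vertices that are still uncovered stay below the bag. -/
theorem mem_below_of_walk (C : BagCovering G h B Δ σ) {j : ℕ} {u v : V} (p : G.graph.Walk u v)
    (hu : u ∈ Δ j) (hp : ∀ z ∈ p.support, j ≤ σ z) : v ∈ Δ j := by
  by_contra hv
  obtain ⟨a, ha, b, hab, ha', hb⟩ := p.reverse.exists_entering_adj (Δ j) hv hu
  obtain ⟨-, i, hi, hai⟩ := C.boundary j a b hab hb ha'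
  rw [SimpleGraph.Walk.support_reverse, List.mem_reverse] at ha
  exact C.notMem_of_lt (hi.trans_le (hp a ha)) hai

theorem mem_below_self (C : BagCovering G h B Δ σ) (v : V) : v ∈ Δ (σ v) := by
  obtain ⟨c, -, hc, -, p, hp⟩ := C.exists_source v
  exact C.mem_below_of_walk p hc fun z hz => (hp z hz).ge

/-- If round `j` reaches the set covered in round `last`, then this set lies below the bag. -/
theorem mem_below_of_reaches (C : BagCovering G h B Δ σ) {last j : ℕ} {s : ℝ}
    (hj : Reaches G σ last s j) {x : V} (hx : σ x = last) : x ∈ Δ j := by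
  obtain ⟨w, w', y, hww', P, hw, hy, hP, -⟩ := hj
  obtain ⟨c, -, hc, -, p, hp⟩ := C.exists_source w
  have hjl : j < last := hy ▸ hP y P.end_mem_support
  have hyΔ : y ∈ Δ j := by
    refine C.mem_below_of_walk (p.append (.cons hww' P)) (hw ▸ hc) fun z hz => ?_
    rw [SimpleGraph.Walk.mem_support_append_iff, SimpleGraph.Walk.support_cons,
      List.mem_cons] at hz
    rcases hz with hz | rfl | hz
    · exact hw ▸ (hp z hz).ge
    · exact hw.ge
    · exact (hP z hz).le
  obtain ⟨d, hd, hdΔ, hσd, q, hq⟩ := C.exists_source y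
  have hdj : d ∈ Δ j := C.mem_below_of_walk q.reverse hyΔ fun z hz => by
    rw [SimpleGraph.Walk.support_reverse, List.mem_reverse] at hz
    rw [hq z hz, hy]; exact hjl.le
  refine C.below_subset j last hjl d (hy ▸ hd) (fun i hi => ?_) hdj (hx ▸ C.mem_below_self x)
  exact C.notMem_of_lt (by rw [hσd, hy]; exact hi)

/-- A walk from outside to below the bag meets the bag. -/
theorem exists_mem_bag (C : BagCovering G h B Δ σ) {j : ℕ} {u v : V} (p : G.graph.Walk u v)
    (hu : u ∉ Δ j) (hv : v ∈ Δ j) : ∃ a ∈ p.support, a ∈ B j := by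
  obtain ⟨a, ha, b, hab, ha', hb⟩ := p.exists_entering_adj (Δ j) hu hv
  exact ⟨a, ha, (C.boundary j a b hab hb ha').1⟩

theorem notMem_below_of_mem_bag (C : BagCovering G h B Δ σ) {i j : ℕ} (hij : i < j) {c : V}
    (hc : c ∈ B i) : c ∉ Δ j :=
  fun hcj => C.notMem_of_mem_below j c hcj i hij hc

-- Let `e'` be the first relevant round whose bag misses the set of `q`; the walk `P` from `q` must
-- then cross this bag itself. Cut `P` after its last vertex `z` covered before `e'`, leaving `R`.
-- If some round before `e` covered a vertex of `R`, the first such round would be reached by a walk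
-- shorter than `s`, against `hlow`. So `R` stays uncovered until `e`, and every relevant bag from
-- `e'` on has to meet the set of `i = σ z`.
open Classical in
theorem persist (C : BagCovering G h B Δ σ) {last q e : ℕ} {s : ℝ}
    (hq : Reaches G σ last (s + h) q) (hqe : q < e) (hel : e ≤ last)
    (hlow : ∀ j, q < j → j < e → ∀ s' < s, ¬ Reaches G σ last s' j) :
    ∃ i e', q ≤ i ∧ i < e' ∧ e' ≤ e ∧ Reaches G σ last (s + h) i ∧
      (∀ j s', Reaches G σ last s' j → q < j → j < e' → ∃ v ∈ B j, σ v = q) ∧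
      (∀ j s', Reaches G σ last s' j → e' ≤ j → j < e → ∃ v ∈ B j, σ v = i) := by
  by_cases hall : ∀ j s', Reaches G σ last s' j → q < j → j < e → ∃ v ∈ B j, σ v = q
  · exact ⟨q, e, le_rfl, hqe, le_rfl, hq, hall, fun j s' _ h1 h2 => absurd h1 (by omega)⟩
  have hex : ∃ j, (∃ s', Reaches G σ last s' j) ∧ q < j ∧ j < e ∧ ¬ ∃ v ∈ B j, σ v = q := by
    push Not at hall ⊢
    obtain ⟨j, s', h1, h2⟩ := hall
    exact ⟨j, ⟨s', h1⟩, h2⟩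
  obtain ⟨e', ⟨⟨s₀, hs₀⟩, hqe', he'e, hmeet⟩, hmin⟩ :
      ∃ e', ((∃ s', Reaches G σ last s' e') ∧ q < e' ∧ e' < e ∧ ¬ ∃ v ∈ B e', σ v = q) ∧
        ∀ j < e', ¬ ((∃ s', Reaches G σ last s' j) ∧ q < j ∧ j < e ∧ ¬ ∃ v ∈ B j, σ v = q) :=
    ⟨Nat.find hex, Nat.find_spec hex, fun j hj => Nat.find_min hex hj⟩
  obtain ⟨w, w', x, hww', P, hw, hx, hP, hlen⟩ := hq
  -- the walk `P` meets the bag of round `e'`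
  obtain ⟨p₀, hp₀P, hp₀⟩ : ∃ p₀ ∈ P.support, p₀ ∈ B e' := by
    obtain ⟨c, hc, -, -, p, hp⟩ := C.exists_source w
    obtain ⟨a, ha, haB⟩ := C.exists_mem_bag (p.append (.cons hww' P))
      (C.notMem_below_of_mem_bag hqe' (hw ▸ hc)) (C.mem_below_of_reaches hs₀ hx)
    rw [SimpleGraph.Walk.mem_support_append_iff, SimpleGraph.Walk.support_cons,
      List.mem_cons] at ha
    rcases ha with ha | rfl | ha
    · exact absurd ⟨a, haB, (hp a ha).trans hw⟩ hmeet
    · exact absurd ⟨_, haB, hw⟩ hmeet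
    · exact ⟨a, ha, haB⟩
  -- the last vertex on the walk that is covered before round `e'`
  obtain ⟨z, v, Q, hzv, R, hQR, hz, hR⟩ := (SimpleGraph.Walk.cons hww' P).exists_last_mem
    (fun y => σ y < e') (by simp only [hx]; omega) ⟨w, by simp, by simp only [hw]; exact hqe'⟩
  obtain ⟨A, hPA⟩ : ∃ (A : G.graph.Walk w' v), P = A.append R := by
    cases Q with
    | nil =>
      cases hQR
      exact ⟨.nil, rfl⟩
    | cons h' Q =>
      cases hQR
      exact ⟨Q.append (.cons hzv .nil), SimpleGraph.Walk.append_assoc Q (.cons hzv .nil) R⟩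
  have hz_ge : q ≤ σ z := by
    have : z ∈ (SimpleGraph.Walk.cons hww' P).support := by
      rw [hQR, SimpleGraph.Walk.mem_support_append_iff]; simp
    rw [SimpleGraph.Walk.support_cons, List.mem_cons] at this
    rcases this with rfl | h'
    · exact hw.ge
    · exact (hP z h').le
  have hRlen : (G.length R : ℝ) ≤ G.length P := by
    rw [hPA, EdgeWeightedGraph.length_append]; push_cast; linarith [(G.length A).coe_nonneg]
  -- the rest of the walk is not touched before round `e`
  have hRe : ∀ y ∈ R.support, e ≤ σ y := by
    by_contra hcon
    push Not at hcon
    have hex' : ∃ j, j < e ∧ ∃ y ∈ R.support, σ y = j := by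
      obtain ⟨y, hy, hye⟩ := hcon
      exact ⟨σ y, hye, y, hy, rfl⟩
    obtain ⟨j, ⟨hje, y, hyR, hyj⟩, hjmin⟩ : ∃ j, (j < e ∧ ∃ y ∈ R.support, σ y = j) ∧
        ∀ i < j, ¬ (i < e ∧ ∃ y ∈ R.support, σ y = i) :=
      ⟨Nat.find hex', Nat.find_spec hex', fun j hj => Nat.find_min hex' hj⟩
    have hje' : e' ≤ j := by
      have := hR y hyR
      omega
    obtain ⟨w₁, w₂, A₁, h₁₂, R₁, hR₁, hw₁, hR₁j⟩ := R.exists_last_mem (fun y => σ y = j)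
      (by simp only [hx]; omega) ⟨y, hyR, hyj⟩
    have hR₁lt : ∀ y ∈ R₁.support, j < σ y := by
      intro y hy
      have h1 := hR₁j y hy
      have h2 : y ∈ R.support := by
        rw [hR₁, SimpleGraph.Walk.mem_support_append_iff]; simp [hy]
      have h3 : ¬ σ y < j := fun hlt => hjmin _ hlt ⟨by omega, y, h2, rfl⟩
      omega
    have hreach : Reaches G σ last (G.length R₁) j :=
      ⟨w₁, w₂, x, h₁₂, R₁, hw₁, hx, hR₁lt, le_rfl⟩
    -- For `j > e'` separation is applied once more, to the walk from `p₀`: this vertex lies in the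
    -- earlier bag of `e'`, hence not below the bag of `j`.
    obtain ⟨p, hpP, hpB⟩ : ∃ p ∈ P.support, p ∈ B j := by
      rcases hje'.eq_or_lt with rfl | hlt
      · exact ⟨p₀, hp₀P, hp₀⟩
      · obtain ⟨a, ha, haB⟩ := C.exists_mem_bag (P.dropUntil p₀ hp₀P)
          (C.notMem_below_of_mem_bag hlt hp₀) (C.mem_below_of_reaches hreach hx)
        exact ⟨a, P.support_dropUntil_subset_support hp₀P ha, haB⟩
    set A₂ := A.append A₁ with hA₂
    have hP₂ : P = A₂.append (.cons h₁₂ R₁) := by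
      rw [hPA, hR₁, hA₂, SimpleGraph.Walk.append_assoc]
    have hpA : p ∈ A₂.support := by
      rw [hP₂, SimpleGraph.Walk.mem_support_append_iff, SimpleGraph.Walk.support_cons,
        List.mem_cons] at hpP
      rcases hpP with h' | rfl | h'
      · exact h'
      · exact A₂.end_mem_support
      · exact absurd (C.covered j p hpB) (by have := hR₁lt p h'; omega)
    -- The vertex `p` comes before `w₂` on `P`, and `w₂` escaped round `j`, so this stretch of `P`
    -- is longer than `h`. The rest `R₁` is then shorter than `s`.
    have hfar := C.far w₁ w₂ h₁₂ (by rw [hw₁]; exact hR₁lt w₂ R₁.start_mem_support) p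
      (hw₁ ▸ hpB) ((A₂.dropUntil p hpA).append (.cons h₁₂ .nil))
    have hle := G.length_dropUntil_le A₂ hpA
    have hPl : (G.length P : ℝ) = G.length A₂ + (G.weight s(w₁, w₂) + G.length R₁) := by
      rw [hP₂]; simp
    have hle' : (G.length (A₂.dropUntil p hpA) : ℝ) ≤ G.length A₂ := by exact_mod_cast hle
    simp only [EdgeWeightedGraph.length_append, EdgeWeightedGraph.length_cons,
      EdgeWeightedGraph.length_nil, NNReal.coe_add, add_zero] at hfar
    exact hlow j (by omega) hje _ (by linarith) hreach
  refine ⟨σ z, e', hz_ge, hz, he'e.le, ⟨z, v, x, hzv, R, rfl, hx, fun y hy => ?_, by linarith⟩,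
    fun j s' hj hqj hje' => ?_, fun j s' hj hj1 hj2 => ?_⟩
  · have := hRe y hy
    omega
  · by_contra hcon
    exact hmin j hje' ⟨⟨s', hj⟩, hqj, by omega, hcon⟩
  · obtain ⟨c, hc, -, -, p, hp⟩ := C.exists_source z
    obtain ⟨a, ha, haB⟩ := C.exists_mem_bag (p.append (.cons hzv R))
      (C.notMem_below_of_mem_bag (by omega) hc) (C.mem_below_of_reaches hj hx)
    rw [SimpleGraph.Walk.mem_support_append_iff, SimpleGraph.Walk.support_cons,
      List.mem_cons] at ha
    rcases ha with ha | rfl | ha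
    · exact ⟨a, haB, hp a ha⟩
    · exact ⟨_, haB, rfl⟩
    · have h1 := hRe a ha
      have h2 := C.covered j a haB
      omega

/-- Distinct rounds cover disjoint sets, so a bag meets at most `k` of them. Level `0` is emptied by
decree, since walks of length `0` may exist; `persist` survives this for `a = 0` because no length
is below `0`. -/
theorem eventSystem (C : BagCovering G h B Δ σ) {k : ℕ} (hk : ∀ j, (B j).card ≤ k)
    (L last : ℕ) :
    EventSystem k L last (fun i j => ∃ v ∈ B j, σ v = i)
      (fun a j => a ≠ 0 ∧ Reaches G σ last (a * h) j) where
  card_le j S hS := by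
    classical
    refine le_trans (Finset.card_le_card (fun i hi => ?_))
      ((Finset.card_image_le (f := σ)).trans (hk j))
    obtain ⟨v, hv, rfl⟩ := hS i hi
    exact Finset.mem_image_of_mem σ hv
  meets_self a j hj := by
    obtain ⟨-, w, w', x, -, P, hw, -⟩ := hj
    obtain ⟨c, hc, -, hσ, -⟩ := C.exists_source w
    exact ⟨c, hw ▸ hc, hσ.trans hw⟩
  mono a b j hab hj := by
    obtain ⟨ha, w, w', x, hww', P, hw, hx, hP, hlen⟩ := hj
    refine ⟨by omega, w, w', x, hww', P, hw, hx, hP, hlen.trans ?_⟩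
    have : (a : ℝ) ≤ b := by exact_mod_cast hab
    exact mul_le_mul_of_nonneg_right this C.pos.le
  not_zero j hj := hj.1 rfl
  persist a q e hq hqe hel hlow := by
    obtain ⟨i, e', h1, h2, h3, h4, h5, h6⟩ := C.persist (s := a * h) (e := e) (last := last)
      (q := q) (by have := hq.2; push_cast at this; rwa [add_mul, one_mul] at this) hqe hel
      (fun j hqj hje s' hs' hR => by
        obtain ⟨w, w', x, hww', P, hw, hx, hP, hlen⟩ := hR
        refine hlow j hqj hje ⟨fun ha => ?_, w, w', x, hww', P, hw, hx, hP, by linarith⟩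
        rw [ha, Nat.cast_zero, zero_mul] at hs'
        linarith [(G.length P).coe_nonneg])
    refine ⟨i, e', h1, h2, h3, ⟨by omega, by push_cast; rwa [add_mul, one_mul]⟩,
      fun j hj => h5 j _ hj.2, fun j hj => h6 j _ hj.2⟩

end BagCovering

/-! ### Separation in tree decompositions along a search order -/

/-- The first `m` values of `t` list all nodes of `T`, each one but the first after a neighbour. -/
structure IsSearchOrder {I : Type*} (T : SimpleGraph I) (m : ℕ) (t : ℕ → I) : Prop where
  inj : ∀ i < m, ∀ j < m, t i = t j → i = j
  surj : ∀ s, ∃ i < m, t i = s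
  adj : ∀ j < m, j ≠ 0 → ∃ i < j, T.Adj (t i) (t j)

/-- The bags in the order of a search of the tree, followed by empty bags. -/
def bagSeq {V I : Type*} (bag : I → Finset V) (m : ℕ) (t : ℕ → I) (j : ℕ) : Finset V :=
  if j < m then bag (t j) else ∅

namespace IsSearchOrder

variable {V I : Type*} {H : SimpleGraph V} {T : SimpleGraph I} {bag : I → Finset V} {m : ℕ}
  {t : ℕ → I}

/-- Some walk leads from node `t j` to the node `s` without using earlier nodes. -/
def Ahead (T : SimpleGraph I) (t : ℕ → I) (j : ℕ) (s : I) : Prop :=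
  ∃ p : T.Walk (t j) s, ∀ x ∈ p.support, ∀ i < j, x ≠ t i

/-- The vertices that occur in the bags ahead of node `t j`, but in no earlier bag. -/
def below (T : SimpleGraph I) (bag : I → Finset V) (m : ℕ) (t : ℕ → I) (j : ℕ) : Set V :=
  {v | j < m ∧ (∀ i < j, v ∉ bagSeq bag m t i) ∧ ∃ s, Ahead T t j s ∧ v ∈ bag s}

theorem exists_walk_visited (ht : IsSearchOrder T m t) :
    ∀ i < m, ∃ p : T.Walk (t 0) (t i), ∀ x ∈ p.support, ∃ l ≤ i, x = t l := by
  intro i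
  induction i using Nat.strong_induction_on with
  | _ i ih =>
    intro hi
    by_cases h0 : i = 0
    · subst h0
      exact ⟨.nil, by simp⟩
    obtain ⟨l, hl, hadj⟩ := ht.adj i hi h0
    obtain ⟨p, hp⟩ := ih l hl (hl.trans hi)
    refine ⟨p.append (.cons hadj .nil), fun x hx => ?_⟩
    rw [SimpleGraph.Walk.mem_support_append_iff] at hx
    simp only [SimpleGraph.Walk.support_cons, SimpleGraph.Walk.support_nil, List.mem_cons,
      List.not_mem_nil, or_false] at hx
    rcases hx with hx | rfl | rfl
    · obtain ⟨l', hl', rfl⟩ := hp x hx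
      exact ⟨l', by omega, rfl⟩
    · exact ⟨l, hl.le, rfl⟩
    · exact ⟨i, le_rfl, rfl⟩

/-- The nodes whose bags contain `v` are connected and avoid all earlier nodes, so one of them being
ahead makes all of them ahead. -/
theorem ahead_of_mem_bag (hT : IsTreeDecomposition H T bag) {j : ℕ} (hj : j < m) {v : V}
    (hv : ∀ i < j, v ∉ bagSeq bag m t i) {s s' : I} (hs : Ahead T t j s) (hvs : v ∈ bag s)
    (hvs' : v ∈ bag s') : Ahead T t j s' := by
  obtain ⟨p, hp⟩ := hs
  obtain ⟨q⟩ := (hT.connected v).preconnected ⟨s, hvs⟩ ⟨s', hvs'⟩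
  obtain ⟨q', hq'⟩ : ∃ q' : T.Walk s s', ∀ x ∈ q'.support, v ∈ bag x := by
    refine ⟨q.map (SimpleGraph.Embedding.induce _).toHom, fun x hx => ?_⟩
    obtain ⟨⟨y, hy⟩, -, rfl⟩ := List.mem_map.1 (SimpleGraph.Walk.support_map _ q ▸ hx)
    exact hy
  refine ⟨p.append q', fun x hx i hi => ?_⟩
  rw [SimpleGraph.Walk.mem_support_append_iff] at hx
  rcases hx with hx | hx
  · exact hp x hx i hi
  · have hy := hq' x hx
    rintro rfl
    refine hv i hi ?_
    rw [bagSeq, if_pos (hi.trans hj)]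
    exact hy

theorem ahead_self (ht : IsSearchOrder T m t) {j : ℕ} (hj : j < m) : Ahead T t j (t j) :=
  ⟨.nil, fun x hx i hi h => by
    rw [SimpleGraph.Walk.support_nil, List.mem_singleton] at hx
    exact absurd (ht.inj j hj i (hi.trans hj) (hx ▸ h)) (by omega)⟩

/-- The part of the tree ahead of `t j` is attached to the earlier nodes at `t j` only. -/
theorem eq_of_adj_visited (ht : IsSearchOrder T m t) (hT : T.IsTree) {i j : ℕ} (hj : j < m)
    (hi : i < j) {s : I} (hs : Ahead T t j s) (hadj : T.Adj s (t i)) : s = t j := by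
  by_contra hne
  have hbr := SimpleGraph.isAcyclic_iff_forall_adj_isBridge.1 hT.isAcyclic hadj
  rw [SimpleGraph.isBridge_iff_forall_walk_mem_edges] at hbr
  obtain ⟨p, hp⟩ := hs
  obtain ⟨l, hl, hadj'⟩ := ht.adj j hj (by omega)
  obtain ⟨q, hq⟩ := ht.exists_walk_visited l (by omega)
  obtain ⟨q', hq'⟩ := ht.exists_walk_visited i (by omega)
  have hsnot : ∀ a < j, s ≠ t a := fun a ha => hp s p.end_mem_support a ha
  -- This walk goes from `s` back to `t j`, to an earlier neighbour, and through visited nodes to `t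
  -- i`. It avoids the edge from `s` to `t i`, which is a bridge.
  have hmem := hbr (p.reverse.append (.cons hadj'.symm (q.reverse.append q')))
  rw [SimpleGraph.Walk.edges_append, SimpleGraph.Walk.edges_cons, SimpleGraph.Walk.edges_append,
    SimpleGraph.Walk.edges_reverse, SimpleGraph.Walk.edges_reverse] at hmem
  simp only [List.mem_append, List.mem_reverse, List.mem_cons] at hmem
  rcases hmem with h | h | h | h
  · exact hp _ (p.snd_mem_support_of_mem_edges h) i hi rfl
  · rw [Sym2.eq_iff] at h
    rcases h with h | h
    · exact hne h.1
    · exact hsnot l hl h.1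
  · obtain ⟨a, ha, h'⟩ := hq _ (q.fst_mem_support_of_mem_edges h)
    exact hsnot a (by omega) h'
  · obtain ⟨a, ha, h'⟩ := hq' _ (q'.fst_mem_support_of_mem_edges h)
    exact hsnot a (by omega) h'

/-- A common bag of `a` and `b` is ahead of `t j`. As `a` is not below, it also occurs in an earlier
bag, and the connected set of nodes containing `a` can get from there to the part ahead only through
`t j`. -/
theorem mem_bag_of_boundary (ht : IsSearchOrder T m t) (hT : IsTreeDecomposition H T bag)
    {j : ℕ} {a b : V} (hab : H.Adj a b) (hb : b ∈ below T bag m t j)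
    (ha : a ∉ below T bag m t j) : a ∈ bagSeq bag m t j ∧ ∃ i < j, a ∈ bagSeq bag m t i := by
  obtain ⟨hj, hbi, s, hs, hbs⟩ := hb
  obtain ⟨s', has', hbs'⟩ := hT.edge a b hab
  have hs' : Ahead T t j s' := ahead_of_mem_bag hT hj hbi hs hbs hbs'
  have hex : ∃ i < j, a ∈ bagSeq bag m t i := by
    by_contra hcon
    push Not at hcon
    exact ha ⟨hj, hcon, s', hs', has'⟩
  refine ⟨?_, hex⟩
  obtain ⟨i, hi, hai⟩ := hex
  rw [bagSeq, if_pos (hi.trans hj)] at hai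
  obtain ⟨q⟩ := (hT.connected a).preconnected ⟨t i, hai⟩ ⟨s', has'⟩
  have hti : ¬ Ahead T t j (t i) := fun ⟨p, hp⟩ => hp _ p.end_mem_support i hi rfl
  obtain ⟨⟨x, hx⟩, -, ⟨y, hy⟩, hxy, hxn, hyn⟩ :=
    q.exists_entering_adj {z | Ahead T t j z.1} hti hs'
  have hxy' : T.Adj x y := hxy
  obtain ⟨p, hp⟩ := hyn
  have hxvis : ∃ l < j, x = t l := by
    by_contra hcon
    push Not at hcon
    refine hxn ⟨p.append (.cons hxy'.symm .nil), fun z hz l hl => ?_⟩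
    rw [SimpleGraph.Walk.mem_support_append_iff] at hz
    simp only [SimpleGraph.Walk.support_cons, SimpleGraph.Walk.support_nil, List.mem_cons,
      List.not_mem_nil, or_false] at hz
    rcases hz with hz | rfl | rfl
    · exact hp z hz l hl
    · exact hp _ p.end_mem_support l hl
    · exact hcon l hl
  obtain ⟨l, hl, rfl⟩ := hxvis
  have := ht.eq_of_adj_visited hT.tree hj hl ⟨p, hp⟩ hxy'.symm
  rw [bagSeq, if_pos hj, ← this]
  exact hy

end IsSearchOrder

/-- The separation properties of a tree decomposition, for bags in search order. -/
theorem IsTreeDecomposition.bagCovering {V I : Type*} {G : EdgeWeightedGraph V}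
    {T : SimpleGraph I} {bag : I → Finset V} {m : ℕ} {t : ℕ → I}
    (hT : IsTreeDecomposition G.graph T bag) (ht : IsSearchOrder T m t) {h : ℝ} (hh : 0 < h)
    {σ : V → ℕ} (hcov : ∀ j, ∀ v ∈ bagSeq bag m t j, σ v ≤ j)
    (hconn : ∀ v, ∃ c ∈ bagSeq bag m t (σ v), ∃ p : G.graph.Walk c v, ∀ z ∈ p.support, σ z = σ v)
    (hfar : ∀ w w', G.graph.Adj w w' → σ w < σ w' → ∀ b ∈ bagSeq bag m t (σ w),
      ∀ p : G.graph.Walk b w', h < G.length p) :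
    BagCovering G h (bagSeq bag m t) (IsSearchOrder.below T bag m t) σ where
  pos := hh
  covered := hcov
  connected := hconn
  far := hfar
  mem_below j c hc hi := by
    have hj : j < m := by
      by_contra hj
      rw [bagSeq, if_neg hj] at hc
      simp at hc
    rw [bagSeq, if_pos hj] at hc
    exact ⟨hj, hi, t j, ht.ahead_self hj, hc⟩
  notMem_of_mem_below j v hv := hv.2.1
  boundary j a b hab hb ha := ht.mem_bag_of_boundary hT hab hb ha
  below_subset i j hij c hc hcj hci := by
    rintro v ⟨hj, hvj, s, ⟨p, hp⟩, hvs⟩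
    rw [bagSeq, if_pos hj] at hc
    obtain ⟨-, -, s', hs', hcs'⟩ := hci
    obtain ⟨q, hq⟩ := IsSearchOrder.ahead_of_mem_bag hT (hij.trans hj)
      (fun l hl => hcj l (hl.trans hij)) hs' hcs' hc
    refine ⟨hij.trans hj, fun l hl => hvj l (hl.trans hij), s, ⟨q.append p, fun x hx l hl => ?_⟩,
      hvs⟩
    rcases (SimpleGraph.Walk.mem_support_append_iff _ _).1 hx with hx | hx
    · exact hq x hx l hl
    · exact hp x hx l (hl.trans hij)

/-! ### Counting the weakly reachable parts -/

/-- There is slack: `(k + 1) ^ (2 * L + 1)` already bounds the left side. -/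
theorem mul_pow_le_pow_bound (k L : ℕ) :
    k * (k * k + 1) ^ L ≤ (2 * L + k + 1) ^ (3 * L + 4) := by
  calc k * (k * k + 1) ^ L ≤ (k + 1) * ((k + 1) ^ 2) ^ L :=
        Nat.mul_le_mul (by omega) (Nat.pow_le_pow_left (by nlinarith) _)
    _ = (k + 1) ^ (2 * L + 1) := by rw [← pow_mul, pow_succ]; ring
    _ ≤ (2 * L + k + 1) ^ (2 * L + 1) := Nat.pow_le_pow_left (by omega) _
    _ ≤ (2 * L + k + 1) ^ (3 * L + 4) := Nat.pow_le_pow_right (by omega) (by omega)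

namespace BagCovering

variable {V : Type*} [Fintype V] {G : EdgeWeightedGraph V} {h : ℝ}
  {B : ℕ → Finset V} {Δ : ℕ → Set V} {σ : V → ℕ}

open Classical in
/-- The sets labelled in one round are at most `k`, and few rounds are relevant. -/
theorem card_labels_le (lab : V → ℕ) (β : V → V)
    (hβ : ∀ v, β v ∈ B (σ v)) (hβlab : ∀ u v, σ u = σ v → β u = β v → lab u = lab v) {k : ℕ}
    (hk : ∀ j, (B j).card ≤ k) (J : Finset ℕ) :
    ((Finset.univ.filter fun v => σ v ∈ J).image lab).card ≤ k * J.card := by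
  have hsub : (Finset.univ.filter fun v => σ v ∈ J).image lab ⊆
      J.biUnion fun j => (Finset.univ.filter fun v => σ v = j).image lab := by
    intro l hl
    simp only [Finset.mem_image, Finset.mem_filter, Finset.mem_univ, true_and,
      Finset.mem_biUnion] at hl ⊢
    obtain ⟨v, hv, rfl⟩ := hl
    exact ⟨σ v, hv, v, rfl, rfl⟩
  refine (Finset.card_le_card hsub).trans ?_
  rw [mul_comm]
  refine Finset.card_biUnion_le_card_mul _ _ _ fun j _ => le_trans ?_ (hk j)
  have : ∀ l ∈ (Finset.univ.filter fun v => σ v = j).image lab, ∃ v, σ v = j ∧ lab v = l := by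
    intro l hl
    simpa using hl
  rcases isEmpty_or_nonempty V with hV | hV
  · simp
  choose! f hf hfl using this
  refine Finset.card_le_card_of_injOn (fun l => β (f l)) (fun l hl => ?_) fun l hl l' hl' hll' => ?_
  · exact hf l hl ▸ hβ (f l)
  · rw [← hfl l hl, ← hfl l' hl']
    exact hβlab _ _ ((hf l hl).trans (hf l' hl').symm) hll'

-- The parts are the classes of equal labels. Those weakly reachable from `X` come from round `last`
-- or from a relevant round, with at most `k` labels each, so both bounds on the number of relevant
-- rounds carry over with a factor `k`.
open Classical in
theorem exists_partition [DecidableEq V] (C : BagCovering G h B Δ σ) (lab : V → ℕ)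
    (hlab : ∀ u v, lab u ≤ lab v → σ u ≤ σ v) (β : V → V) (hβ : ∀ v, β v ∈ B (σ v))
    (hβlab : ∀ u v, σ u = σ v → β u = β v → lab u = lab v) {ρ : ℝ} (hρ : ρ = 2 * h)
    (hdist : ∀ u v, lab u = lab v → G.dist u v ≤ ENNReal.ofReal ρ) :
    ∃ (P : Finpartition (Finset.univ : Finset V)) (le : P.parts → P.parts → Prop),
      IsLinearOrder P.parts le ∧
      (∀ X Y : P.parts, ∀ u ∈ X.1, ∀ v ∈ Y.1, (le X Y ↔ lab u ≤ lab v)) ∧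
      (∀ X ∈ P.parts, G.weakDiam (X : Set V) ≤ ENNReal.ofReal ρ) ∧
      ∀ k : ℕ, (∀ j, (B j).card ≤ k) → ∀ r : ℝ, ρ < r →
        G.wcol r P le ≤
          min (k * 2 ^ k * Nat.choose (k + ⌈2 * (r / ρ)⌉₊) k)
            ((2 * ⌈2 * r / ρ⌉₊ + k + 1) ^ (3 * ⌈2 * r / ρ⌉₊ + 4)) := by
  set P : Finpartition (Finset.univ : Finset V) := Finpartition.ofSetoid (Setoid.ker lab) with hP
  have hne : ∀ X : P.parts, ∃ u, u ∈ X.1 := fun X => P.nonempty_of_mem_parts X.2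
  choose rep hrep using hne
  have hmem : ∀ X : P.parts, ∀ u ∈ X.1, ∀ v, v ∈ X.1 ↔ lab u = lab v := by
    intro X u hu v
    rw [← P.part_eq_of_mem X.2 hu, hP, Finpartition.mem_part_ofSetoid_iff_rel]
    rfl
  have hle : ∀ X Y : P.parts, ∀ u ∈ X.1, ∀ v ∈ Y.1,
      (lab (rep X) ≤ lab (rep Y) ↔ lab u ≤ lab v) := by
    intro X Y u hu v hv
    rw [(hmem X _ (hrep X) u).1 hu, (hmem Y _ (hrep Y) v).1 hv]
  have hinj : ∀ X Y : P.parts, lab (rep X) = lab (rep Y) → X = Y := by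
    intro X Y hXY
    have := (hmem X _ (hrep X) (rep Y)).2 hXY
    exact Subtype.ext (P.eq_of_mem_parts X.2 Y.2 this (hrep Y))
  refine ⟨P, fun X Y => lab (rep X) ≤ lab (rep Y), ?_, hle, ?_, ?_⟩
  · exact { refl := fun X => le_rfl
            trans := fun X Y Z h1 h2 => le_trans h1 h2
            antisymm := fun X Y h1 h2 => hinj X Y (le_antisymm h1 h2)
            total := fun X Y => le_total _ _ }
  · intro X hX
    refine iSup₂_le fun u hu => iSup₂_le fun v hv => hdist u v ?_
    exact (hmem ⟨X, hX⟩ u hu v).1 hv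
  · intro k hk r hr
    have hρ0 : 0 < ρ := by have := C.pos; linarith
    set L := ⌈2 * (r / ρ)⌉₊ with hL
    rw [show 2 * r / ρ = 2 * (r / ρ) by ring, ← hL]
    have hrL : r ≤ L * h := by
      have h1 := Nat.le_ceil (2 * (r / ρ))
      rw [← hL] at h1
      have h2 : 2 * (r / ρ) * h = r := by
        rw [hρ]; have := C.pos.ne'; field_simp
      rw [← h2]
      exact mul_le_mul_of_nonneg_right h1 C.pos.le
    have hL0 : L ≠ 0 := by
      have : 0 < 2 * (r / ρ) := by have := hρ0.trans hr; positivity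
      exact (Nat.ceil_pos.2 this).ne'
    refine Finset.sup_le fun X _ => ?_
    set last := σ (rep X) with hlast
    obtain ⟨Lvl, hLvl⟩ : ∃ Lvl : ℕ → ℕ → Prop,
        Lvl = fun (a j : ℕ) => a ≠ 0 ∧ Reaches G σ last (a * h) j := ⟨_, rfl⟩
    have E := C.eventSystem hk L last
    rw [← hLvl] at E
    set J := (Finset.range last).filter (Lvl L) with hJ
    have hcard : (G.wreach r P (fun X Y => lab (rep X) ≤ lab (rep Y)) X).ncard ≤
        k * (J.card + 1) := by
      have hJ' : (insert last J).card = J.card + 1 :=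
        Finset.card_insert_of_notMem (by simp [hJ])
      rw [← hJ']
      refine le_trans ?_ (card_labels_le lab β hβ hβlab hk (insert last J))
      rw [← Set.ncard_coe_finset]
      refine Set.ncard_le_ncard_of_injOn (fun Y => lab (rep Y)) (fun Y hY => ?_)
        (fun Y _ Y' _ hYY' => hinj Y Y' hYY') (Finset.finite_toSet _)
      obtain ⟨x, hx, y, hy, p, -, hlen, hp⟩ := hY
      have hσ : ∀ u v, lab u = lab v → σ u = σ v := fun u v huv =>
        le_antisymm (hlab _ _ huv.le) (hlab _ _ huv.ge)
      have hxl : σ x = last := (hσ _ _ ((hmem X _ (hrep X) x).1 hx)).symm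
      have hp' : ∀ z ∈ p.support, σ y ≤ σ z := fun z hz => by
        obtain ⟨Z, hYZ, hzZ⟩ := hp z hz
        exact hlab _ _ ((hle Y Z y hy z hzZ).1 hYZ)
      refine Finset.mem_coe.2 (Finset.mem_image.2 ⟨y, ?_, ((hmem Y _ (hrep Y) y).1 hy).symm⟩)
      simp only [Finset.mem_filter, Finset.mem_univ, true_and, Finset.mem_insert, hJ,
        Finset.mem_range]
      rcases (hxl ▸ hp' x p.start_mem_support : σ y ≤ last).eq_or_lt with heq | hlt
      · exact Or.inl heq
      refine Or.inr ⟨hlt, ?_⟩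
      rw [hLvl]
      refine ⟨hL0, ?_⟩
      -- Read from `y` to `x`, the walk is cut at the last vertex covered in the round of `y`. The
      -- rest uses only vertices covered later.
      obtain ⟨w, w', q, hww', q', hq, hw, hq'⟩ := p.reverse.exists_last_mem (fun z => σ z = σ y)
        (by simp only [hxl]; omega) ⟨y, by simp, rfl⟩
      refine ⟨w, w', x, hww', q', hw, hxl, fun z hz => ?_, ?_⟩
      · have h1 : z ∈ p.reverse.support := by
          rw [hq, SimpleGraph.Walk.mem_support_append_iff]; simp [hz]
        rw [SimpleGraph.Walk.support_reverse, List.mem_reverse] at h1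
        exact lt_of_le_of_ne (hp' z h1) fun h => hq' z hz h.symm
      · have h1 : (G.length p : ℝ) = G.length q + (G.weight s(w, w') + G.length q') := by
          rw [← G.length_reverse, hq]; simp
        have h2 := (G.length q).coe_nonneg
        have h3 := (G.weight s(w, w')).coe_nonneg
        linarith
    have h1 : 2 * J.card + 1 ≤ 2 ^ k * (L + k).choose k := by
      convert E.two_mul_card_add_one_le
    have h2 : J.card + 1 ≤ (k * k + 1) ^ L := by
      convert E.card_add_one_le_pow L le_rfl
    refine hcard.trans (le_min ?_ ?_)
    · rw [mul_assoc, add_comm k L]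
      exact Nat.mul_le_mul_left k (by omega)
    · exact (Nat.mul_le_mul_left k h2).trans (mul_pow_le_pow_bound k L)

end BagCovering

noncomputable section

/-! ### Total correctness with a step bound

The natural number arrays from `100` on hold loop counters; the rest of the memory is the data. -/

/-- The memory without the loop counters. -/
def Memory.data (s : Memory) : Memory :=
  { s with nat := fun a i j => if a < 100 then s.nat a i j else 0 }

@[simp] theorem Memory.data_real (s : Memory) : s.data.real = s.real := rfl

theorem Memory.data_nat (s : Memory) {a : ℕ} (ha : a < 100) : s.data.nat a = s.nat a := by
  funext i j
  exact if_pos ha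

/-- Started in `s`, the program `p` halts after at most `T` steps, changes no counter below `c`, and
leaves data with the property `Q`. -/
def Runs (c : ℕ) (p : Program) (s : Memory) (T : ℕ) (Q : Memory → Prop) : Prop :=
  ∃ s' t, Exec p s s' t ∧ t ≤ T ∧ (∀ a, 100 ≤ a → a < c → s'.nat a = s.nat a) ∧ Q s'.data

namespace Runs

variable {c T T' : ℕ} {p q : Program} {s : Memory} {Q Q' : Memory → Prop}

theorem mono (h : Runs c p s T Q) (hT : T ≤ T') (hQ : ∀ d, Q d → Q' d) : Runs c p s T' Q' := by
  obtain ⟨s', t, he, ht, hc, hq⟩ := h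
  exact ⟨s', t, he, ht.trans hT, hc, hQ _ hq⟩

theorem skip (h : Q s.data) : Runs c .skip s 1 Q :=
  ⟨s, 1, .skip s, le_rfl, fun _ _ _ => rfl, h⟩

theorem setNat {a : ℕ} {i j e : NatExpr} (ha : a < 100)
    (h : Q { s.data with nat := updateCell s.data.nat a (i.eval s) (j.eval s) (e.eval s) }) :
    Runs c (.setNat a i j e) s 1 Q := by
  refine ⟨_, 1, .setNat s a i j e, le_rfl, fun b hb _ => ?_, ?_⟩
  · funext i' j'
    exact if_neg fun hh => absurd hh.1 (by omega)
  · convert h using 1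
    simp only [Memory.data, Memory.mk.injEq, and_true]
    funext b i' j'
    simp only [updateCell]
    by_cases hh : b = a ∧ i' = i.eval s ∧ j' = j.eval s
    · simp [hh, ha]
    · simp [hh]

theorem setReal {a : ℕ} {i j : NatExpr} {e : RealExpr}
    (h : Q { s.data with real := updateCell s.data.real a (i.eval s) (j.eval s) (e.eval s) }) :
    Runs c (.setReal a i j e) s 1 Q :=
  ⟨_, 1, .setReal s a i j e, le_rfl, fun _ _ _ => rfl, h⟩

theorem seq (hp : Runs c p s T Q)
    (hq : ∀ s', (∀ a, 100 ≤ a → a < c → s'.nat a = s.nat a) → Q s'.data → Runs c q s' T' Q') :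
    Runs c (.seq p q) s (T + T') Q' := by
  obtain ⟨s', t, he, ht, hc, hQ⟩ := hp
  obtain ⟨s'', t', he', ht', hc', hQ'⟩ := hq s' hc hQ
  exact ⟨s'', t + t', .seq he he', by omega, fun a h1 h2 => (hc' a h1 h2).trans (hc a h1 h2), hQ'⟩

theorem ite {b : Test} (hp : b.Holds s → Runs c p s T Q) (hq : ¬ b.Holds s → Runs c q s T Q) :
    Runs c (.ite b p q) s (T + 1) Q := by
  by_cases hb : b.Holds s
  · obtain ⟨s', t, he, ht, hc, hQ⟩ := hp hb
    exact ⟨s', t + 1, .iteTrue hb he, by omega, hc, hQ⟩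
  · obtain ⟨s', t, he, ht, hc, hQ⟩ := hq hb
    exact ⟨s', t + 1, .iteFalse hb he, by omega, hc, hQ⟩

theorem ifThen {b : Test} (hp : b.Holds s → Runs c p s 1 Q) (hq : ¬ b.Holds s → Q s.data) :
    Runs c (.ite b p .skip) s 2 Q :=
  ite hp fun h => skip (hq h)

end Runs

/-- The counter `c`. -/
def counter (c : ℕ) : NatExpr := .get c (.const 0) (.const 0)

@[simp] theorem counter_eval (c : ℕ) (s : Memory) : (counter c).eval s = s.nat c 0 0 := rfl

/-- Run `p` for all values of the counter `c` below the value of the data cell `(0, 0, x)`. -/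
def forLoop (c x : ℕ) (p : Program) : Program :=
  .seq (.setNat c (.const 0) (.const 0) (.const 0))
    (.while (.natLE (.add (counter c) (.const 1)) (.get 0 (.const 0) (.const x)))
      (.seq p (.setNat c (.const 0) (.const 0) (.add (counter c) (.const 1)))))

namespace Runs

variable {c T : ℕ} {p : Program} {s : Memory}

theorem setCounter_data (s : Memory) (hc : 100 ≤ c) (x : ℕ) :
    ({ s with nat := updateCell s.nat c 0 0 x } : Memory).data = s.data := by
  simp only [Memory.data, Memory.mk.injEq, and_true]
  funext b i j
  by_cases hb : b < 100
  · simp [updateCell, hb, show b ≠ c by omega]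
  · simp [hb]

/-- A pass costs the body, a test and an increment; the initialisation and the failing test add `2`.
The body runs at `c + 1`, so it cannot disturb the counter `c`, and `I` sees only data, so the
increment cannot disturb `I`. -/
theorem forLoop {x K q : ℕ} (hc : 100 ≤ c) (hKq : K ≤ q) {I : ℕ → Memory → Prop}
    (hN : ∀ i d, I i d → d.nat 0 0 x = K) (h0 : I 0 s.data)
    (hstep : ∀ i < K, ∀ s', (∀ a, 100 ≤ a → a < c → s'.nat a = s.nat a) → s'.nat c 0 0 = i →
      I i s'.data → Runs (c + 1) p s' T (I (i + 1))) :
    Runs c (forLoop c x p) s (q * (T + 2) + 2) (I K) := by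
  have key : ∀ l i s', i + l = K → (∀ a, 100 ≤ a → a < c → s'.nat a = s.nat a) →
      s'.nat c 0 0 = i → I i s'.data → Runs c
        (.while (.natLE (.add (counter c) (.const 1)) (.get 0 (.const 0) (.const x)))
          (.seq p (.setNat c (.const 0) (.const 0) (.add (counter c) (.const 1)))))
        s' (l * (T + 2) + 1) (I K) := by
    intro l
    induction l with
    | zero =>
      intro i s' hi hs' hci hI
      obtain rfl : i = K := by omega
      have hK := hN _ _ hI
      rw [Memory.data_nat _ (by norm_num)] at hK
      exact ⟨s', 1, .whileFalse (by simp [Test.Holds, NatExpr.eval, hci, hK]), by omega,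
        fun _ _ _ => rfl, hI⟩
    | succ l ih =>
      intro i s' hi hs' hci hI
      have hK := hN _ _ hI
      rw [Memory.data_nat _ (by norm_num)] at hK
      obtain ⟨s₁, t₁, he₁, ht₁, hc₁, hI₁⟩ := hstep i (by omega) s' hs' hci hI
      set s₂ : Memory := { s₁ with nat := updateCell s₁.nat c 0 0 (i + 1) } with hs₂
      have hex : Exec (.setNat c (.const 0) (.const 0) (.add (counter c) (.const 1))) s₁ s₂ 1 := by
        have := Exec.setNat s₁ c (.const 0) (.const 0) (.add (counter c) (.const 1))
        simpa only [NatExpr.eval, counter_eval, hc₁ c hc (by omega), hci] using this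
      have hkeep : ∀ a, 100 ≤ a → a < c → s₂.nat a = s'.nat a := fun a ha hac => by
        rw [← hc₁ a ha (by omega)]
        funext i' j'
        exact if_neg fun hh => absurd hh.1 (by omega)
      obtain ⟨s₃, t₃, he₃, ht₃, hc₃, hI₃⟩ := ih (i + 1) s₂ (by omega)
        (fun a ha hac => (hkeep a ha hac).trans (hs' a ha hac)) (by simp [hs₂, updateCell])
        (by rw [setCounter_data _ hc]; exact hI₁)
      refine ⟨s₃, _, .whileTrue ?_ (.seq he₁ hex) he₃, ?_,
        fun a ha hac => (hc₃ a ha hac).trans (hkeep a ha hac), hI₃⟩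
      · simp [Test.Holds, NatExpr.eval, hci, hK]; omega
      · rw [Nat.succ_mul]; omega
  have hset := Exec.setNat s c (.const 0) (.const 0) (.const 0)
  obtain ⟨s', t, he, ht, hc', hI⟩ := key K 0
    { s with nat := updateCell s.nat c 0 0 0 } (by omega)
    (fun a ha hac => by
      funext i' j'
      exact if_neg fun hh => absurd hh.1 (by omega))
    (by simp [updateCell]) (by rw [setCounter_data _ hc]; exact h0)
  refine ⟨s', _, .seq hset he, ?_, fun a ha hac => ?_, hI⟩
  · have := Nat.mul_le_mul_right (T + 2) hKq
    omega
  · rw [hc' a ha hac]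
    funext i' j'
    exact if_neg fun hh => absurd hh.1 (by omega)

/-- A loop whose body improves the data in some preorder, and establishes a stable property of the
value of the counter. -/
theorem forLoop_mono {x K q : ℕ} (hc : 100 ≤ c) (hKq : K ≤ q) {Inv : Memory → Prop}
    {Le : Memory → Memory → Prop} {Φ : ℕ → Memory → Prop}
    (hN : ∀ d, Inv d → d.nat 0 0 x = K) (hrefl : ∀ d, Le d d)
    (htrans : ∀ d₁ d₂ d₃, Le d₁ d₂ → Le d₂ d₃ → Le d₁ d₃)
    (hstable : ∀ i d d', Le d d' → Φ i d → Φ i d') (h0 : Inv s.data)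
    (hstep : ∀ i < K, ∀ s', (∀ a, 100 ≤ a → a < c → s'.nat a = s.nat a) → s'.nat c 0 0 = i →
      Inv s'.data → Runs (c + 1) p s' T (fun d => Inv d ∧ Le s'.data d ∧ Φ i d)) :
    Runs c (_root_.forLoop c x p) s (q * (T + 2) + 2)
      (fun d => Inv d ∧ Le s.data d ∧ ∀ i < K, Φ i d) := by
  refine forLoop (I := fun i d => Inv d ∧ Le s.data d ∧ ∀ i' < i, Φ i' d) hc hKq
    (fun i d h => hN d h.1) ⟨h0, hrefl _, by simp⟩ fun i hi s' hs' hci hI => ?_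
  refine (hstep i hi s' hs' hci hI.1).mono le_rfl fun d hd =>
    ⟨hd.1, htrans _ _ _ hI.2.1 hd.2.1, fun i' hi' => ?_⟩
  rcases Nat.lt_succ_iff_lt_or_eq.1 hi' with h | rfl
  · exact hstable _ _ _ hd.2.1 (hI.2.2 i' h)
  · exact hd.2.2

end Runs


/-! ### The input -/

section Input

variable {n m : ℕ} (G : EdgeWeightedGraph (Fin n)) (T : SimpleGraph (Fin m))
  (bag : Fin m → Finset (Fin n)) (ρ : ℝ)

theorem tableEntry_coe {α : Type} [Zero α] {n m : ℕ} (f : Fin n → Fin m → α) (i : Fin n)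
    (j : Fin m) : tableEntry f i j = f i j := by
  simp [tableEntry]

open Classical in
theorem inputMemory_adj (u v : Fin n) :
    (inputMemory G T bag ρ).nat 1 u v = if G.graph.Adj u v then 1 else 0 :=
  tableEntry_coe (fun u v => if G.graph.Adj u v then 1 else 0) u v

open Classical in
theorem inputMemory_tree (s t : Fin m) :
    (inputMemory G T bag ρ).nat 2 s t = if T.Adj s t then 1 else 0 :=
  tableEntry_coe (fun s t => if T.Adj s t then 1 else 0) s t

open Classical in
theorem inputMemory_bag (t : Fin m) (v : Fin n) :
    (inputMemory G T bag ρ).nat 3 t v = if v ∈ bag t then 1 else 0 :=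
  tableEntry_coe (fun t v => if v ∈ bag t then 1 else 0) t v

theorem inputMemory_weight (u v : Fin n) (h : G.graph.Adj u v) :
    (inputMemory G T bag ρ).real 0 u v = G.weight s(u, v) := by
  classical
  refine (tableEntry_coe
    (fun u v => if G.graph.Adj u v then (G.weight s(u, v) : ℝ) else 0) u v).trans ?_
  simp [h]

theorem inputMemory_nat_zero {a : ℕ} (ha : 4 ≤ a) (i j : ℕ) :
    (inputMemory G T bag ρ).nat a i j = 0 := by
  obtain ⟨a, rfl⟩ := Nat.exists_eq_add_of_le ha
  rw [add_comm]
  rfl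

theorem inputMemory_data : (inputMemory G T bag ρ).data = inputMemory G T bag ρ := by
  simp only [Memory.data, inputMemory, Memory.mk.injEq, and_true]
  funext a i j
  by_cases ha : a < 100
  · exact if_pos ha
  · rw [if_neg ha]
    exact (inputMemory_nat_zero G T bag ρ (by omega) i j).symm

end Input

/-! ### Distances

The real array `2` is set to the distances between vertices, as far as they are less than `ρ`. -/

/-- The cell of the real array `1` that holds the given bound. -/
def boundExpr : RealExpr := .get 1 (.const 0) (.const 0)

/-- The bound `ρ` plays the role of infinity. Zero is obtained as a difference, as there are no real
constants. -/
def initDistProgram : Program :=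
  forLoop 100 0 (forLoop 101 0
    (.ite (.and (.natLE (counter 100) (counter 101)) (.natLE (counter 101) (counter 100)))
      (.setReal 2 (counter 100) (counter 101) (.sub boundExpr boundExpr))
      (.ite (.natLE (.const 1) (.get 1 (counter 100) (counter 101)))
        (.setReal 2 (counter 100) (counter 101) (.get 0 (counter 100) (counter 101)))
        (.setReal 2 (counter 100) (counter 101) boundExpr))))

/-- The sum of two table entries that is compared with the entry at the counters `101`, `103`. -/
def viaExpr : RealExpr :=
  .add (.get 2 (counter 101) (counter 102)) (.get 2 (counter 102) (counter 103))

def relaxRoundProgram : Program :=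
  forLoop 101 0 (forLoop 102 0 (forLoop 103 0
    (.ite (.realLE viaExpr (.get 2 (counter 101) (counter 103)))
      (.setReal 2 (counter 101) (counter 103) viaExpr) .skip)))

def distProgram : Program :=
  .seq initDistProgram (forLoop 100 0 relaxRoundProgram)

section Dist

variable {n m : ℕ} {G : EdgeWeightedGraph (Fin n)} {T : SimpleGraph (Fin m)}
  {bag : Fin m → Finset (Fin n)} {ρ : ℝ}

/-- Only the table of distances has been changed. -/
def KeepsInput (inp d : Memory) : Prop :=
  d.nat = inp.nat ∧ ∀ a < 2, d.real a = inp.real a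

open Classical in
/-- The table of distances at the start. -/
def startDist (G : EdgeWeightedGraph (Fin n)) (ρ : ℝ) (i j : Fin n) : ℝ :=
  if i = j then 0 else if G.graph.Adj i j then G.weight s(i, j) else ρ

theorem initDistProgram_runs {q : ℕ} (hq : n ≤ q) {c : ℕ} (hc : c ≤ 100) :
    Runs c initDistProgram (inputMemory G T bag ρ) (q * (q * 5 + 2 + 2) + 2)
      (fun d => KeepsInput (inputMemory G T bag ρ) d ∧
        ∀ i j : Fin n, d.real 2 i j = startDist G ρ i j) := by
  set inp := inputMemory G T bag ρ with hinp
  have hN : ∀ d, KeepsInput inp d → d.nat 0 0 0 = n := fun d hd => by rw [hd.1]; rfl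
  have main : Runs 100 initDistProgram inp (q * (q * 5 + 2 + 2) + 2)
      (fun d => KeepsInput inp d ∧
        (∀ i j : Fin n, inp.data.real 2 i j = startDist G ρ i j →
          d.real 2 i j = startDist G ρ i j) ∧
        ∀ i < n, ∀ hi : i < n, ∀ j : Fin n, d.real 2 i j = startDist G ρ ⟨i, hi⟩ j) := by
    refine Runs.forLoop_mono (Inv := KeepsInput inp)
      (Le := fun d d' => ∀ i j : Fin n, d.real 2 i j = startDist G ρ i j →
        d'.real 2 i j = startDist G ρ i j)
      (Φ := fun i d => ∀ hi : i < n, ∀ j : Fin n, d.real 2 i j = startDist G ρ ⟨i, hi⟩ j)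
      le_rfl hq hN (fun _ _ _ h => h) (fun _ _ _ h h' i j hij => h' i j (h i j hij))
      (fun i d d' hle h hi j => hle ⟨i, hi⟩ j (h hi j))
      (by rw [hinp, inputMemory_data]; exact ⟨rfl, fun _ _ => rfl⟩) fun i hi s _ hsi hs => ?_
    refine (Runs.forLoop_mono (Inv := KeepsInput inp) (T := 3)
      (Le := fun d d' => ∀ i j : Fin n, d.real 2 i j = startDist G ρ i j →
        d'.real 2 i j = startDist G ρ i j)
      (Φ := fun j d => ∀ hj : j < n, d.real 2 i j = startDist G ρ ⟨i, hi⟩ ⟨j, hj⟩)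
      (by norm_num) hq hN (fun _ _ _ h => h) (fun _ _ _ h h' i j hij => h' i j (h i j hij))
      (fun j d d' hle h hj => hle ⟨i, hi⟩ ⟨j, hj⟩ (h hj)) hs fun j hj s' hs' hsj' hk => ?_).mono
      le_rfl fun d hd => ⟨hd.1, hd.2.1, fun hi j => hd.2.2 j j.2 j.2⟩
    have hsi' : s'.nat 100 0 0 = i := by rw [hs' 100 le_rfl (by norm_num), hsi]
    have hset : ∀ e : RealExpr, e.eval s' = startDist G ρ ⟨i, hi⟩ ⟨j, hj⟩ →
        Runs 102 (.setReal 2 (counter 100) (counter 101) e) s' 1 (fun d => KeepsInput inp d ∧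
          (∀ i j : Fin n, s'.data.real 2 i j = startDist G ρ i j →
            d.real 2 i j = startDist G ρ i j) ∧
          ∀ hj : j < n, d.real 2 i j = startDist G ρ ⟨i, hi⟩ ⟨j, hj⟩) := by
      intro e he
      refine Runs.setReal ⟨⟨hk.1, fun a ha => ?_⟩, fun i' j' h => ?_, fun hj => ?_⟩
      · rw [← hk.2 a ha]
        funext x y
        exact if_neg fun hh => absurd hh.1 (by omega)
      · simp only [updateCell, counter_eval, hsi', hsj', true_and]
        split_ifs with hij
        · rw [he]
          congr 1 <;> exact Fin.ext (by simp [hij])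
        · exact h
      · simp only [updateCell, counter_eval, hsi', hsj', and_self, if_true, he]
    refine Runs.ite (T := 2) (fun hb => (hset _ ?_).mono (by norm_num) fun _ h => h) fun hb =>
      Runs.ite (T := 1) (fun hb' => hset _ ?_) fun hb' => hset _ ?_
    · simp only [Test.Holds, counter_eval, hsi', hsj'] at hb
      obtain rfl : i = j := by omega
      simp [RealExpr.eval, startDist]
    · simp only [Test.Holds, NatExpr.eval, counter_eval, hsi', hsj'] at hb hb'
      have hij : (⟨i, hi⟩ : Fin n) ≠ ⟨j, hj⟩ := fun h => hb (by simp_all)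
      rw [← Memory.data_nat _ (by norm_num), hk.1, hinp,
        inputMemory_adj G T bag ρ ⟨i, hi⟩ ⟨j, hj⟩] at hb'
      have hadj : G.graph.Adj ⟨i, hi⟩ ⟨j, hj⟩ := by
        by_contra h; simp [h] at hb'
      simp only [RealExpr.eval, counter_eval, hsi', hsj', startDist, hij, if_false, hadj, if_true]
      rw [← Memory.data_real, hk.2 0 (by norm_num)]
      exact inputMemory_weight G T bag ρ ⟨i, hi⟩ ⟨j, hj⟩ hadj
    · simp only [Test.Holds, NatExpr.eval, counter_eval, hsi', hsj'] at hb hb'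
      have hij : (⟨i, hi⟩ : Fin n) ≠ ⟨j, hj⟩ := fun h => hb (by simp_all)
      rw [← Memory.data_nat _ (by norm_num), hk.1, hinp,
        inputMemory_adj G T bag ρ ⟨i, hi⟩ ⟨j, hj⟩] at hb'
      have hadj : ¬ G.graph.Adj ⟨i, hi⟩ ⟨j, hj⟩ := fun h => hb' (by simp [h])
      simp only [boundExpr, RealExpr.eval, NatExpr.eval, startDist, hij, if_false, hadj]
      rw [← Memory.data_real, hk.2 1 (by norm_num)]
      rfl
  obtain ⟨s', t, h1, h2, h3, h4⟩ := main
  exact ⟨s', t, h1, h2, fun a ha hac => h3 a ha (by omega), h4.1,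
    fun i j => h4.2.2 i i.2 i.2 j⟩

/-- Every entry of the table is the length of a walk, or is at least `ρ`. -/
def DistSound (G : EdgeWeightedGraph (Fin n)) (ρ : ℝ) (d : Memory) : Prop :=
  ∀ i j : Fin n, 0 ≤ d.real 2 i j ∧
    (ρ ≤ d.real 2 i j ∨ ∃ p : G.graph.Walk i j, (G.length p : ℝ) ≤ d.real 2 i j)

/-- The table is changed in place, so a test may see entries that are already improved. Since
entries only decrease, the estimates against the table at the start of the round persist. -/
theorem relaxRoundProgram_runs {q : ℕ} (hq : n ≤ q) {inp : Memory} (hn : inp.nat 0 0 0 = n)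
    {s : Memory} (hs : KeepsInput inp s.data) (hsound : DistSound G ρ s.data) :
    Runs 101 relaxRoundProgram s (q * (q * (q * 4 + 2 + 2) + 2 + 2) + 2)
      (fun d => KeepsInput inp d ∧ DistSound G ρ d ∧
        ∀ i l j : Fin n, d.real 2 i j ≤ s.data.real 2 i l + s.data.real 2 l j) := by
  set Inv : Memory → Prop := fun d => KeepsInput inp d ∧ DistSound G ρ d ∧
    ∀ i j : Fin n, d.real 2 i j ≤ s.data.real 2 i j with hInv
  set Le : Memory → Memory → Prop := fun d d' => ∀ i j : Fin n, d'.real 2 i j ≤ d.real 2 i j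
  have hN : ∀ d, Inv d → d.nat 0 0 0 = n := fun d hd => by rw [hd.1.1, hn]
  have hrefl : ∀ d, Le d d := fun _ _ _ => le_rfl
  have htrans : ∀ d₁ d₂ d₃, Le d₁ d₂ → Le d₂ d₃ → Le d₁ d₃ :=
    fun _ _ _ h h' i j => (h' i j).trans (h i j)
  refine (Runs.forLoop_mono (Inv := Inv) (Le := Le)
    (Φ := fun i d => ∀ (_ : i < n) (l j : Fin n),
      d.real 2 i j ≤ s.data.real 2 i l + s.data.real 2 l j)
    (by norm_num) hq hN hrefl htrans
    (fun i d d' hle h hi l j => (hle ⟨i, hi⟩ j).trans (h hi l j))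
    ⟨hs, hsound, fun _ _ => le_rfl⟩ fun i hi s₁ _ hi₁ hI₁ => ?_).mono le_rfl
    fun d hd => ⟨hd.1.1, hd.1.2.1, fun i l j => hd.2.2 i i.2 i.2 l j⟩
  refine (Runs.forLoop_mono (Inv := Inv) (Le := Le)
    (Φ := fun l d => ∀ (_ : l < n) (j : Fin n),
      d.real 2 i j ≤ s.data.real 2 i l + s.data.real 2 l j)
    (by norm_num) hq hN hrefl htrans
    (fun l d d' hle h hl j => (hle ⟨i, hi⟩ j).trans (h hl j))
    hI₁ fun l hl s₂ hs₂ hl₂ hI₂ => ?_).mono le_rfl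
    fun d hd => ⟨hd.1, hd.2.1, fun _ l j => hd.2.2 l l.2 l.2 j⟩
  refine (Runs.forLoop_mono (Inv := Inv) (Le := Le) (T := 2)
    (Φ := fun j d => j < n → d.real 2 i j ≤ s.data.real 2 i l + s.data.real 2 l j)
    (by norm_num) hq hN hrefl htrans
    (fun j d d' hle h hj => (hle ⟨i, hi⟩ ⟨j, hj⟩).trans (h hj))
    hI₂ fun j hj s₃ hs₃ hj₃ hI₃ => ?_).mono le_rfl
    fun d hd => ⟨hd.1, hd.2.1, fun _ j => hd.2.2 j j.2 j.2⟩
  have hl₃ : s₃.nat 102 0 0 = l := by rw [hs₃ 102 (by norm_num) (by norm_num), hl₂]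
  have hi₃ : s₃.nat 101 0 0 = i := by
    rw [hs₃ 101 (by norm_num) (by norm_num), hs₂ 101 (by norm_num) (by norm_num), hi₁]
  have hil := hI₃.2.2 ⟨i, hi⟩ ⟨l, hl⟩
  have hlj := hI₃.2.2 ⟨l, hl⟩ ⟨j, hj⟩
  simp only [Memory.data_real] at hil hlj
  refine Runs.ifThen (fun hb => Runs.setReal ?_) fun hb => ?_
  · simp only [Test.Holds, viaExpr, RealExpr.eval, counter_eval, hi₃, hl₃, hj₃] at hb
    simp only [viaExpr, RealExpr.eval, counter_eval, hi₃, hl₃, hj₃, Memory.data_real]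
    have hcell : ∀ i' j' : Fin n, updateCell s₃.real 2 i j (s₃.real 2 i l + s₃.real 2 l j) 2 i' j' ≤
        s₃.real 2 i' j' := by
      intro i' j'
      simp only [updateCell, true_and]
      split_ifs with h
      · rw [h.1, h.2]; exact hb
      · exact le_rfl
    refine ⟨⟨⟨hI₃.1.1, fun a ha => ?_⟩, fun i' j' => ?_, fun i' j' => ?_⟩, hcell, fun _ => ?_⟩
    · rw [← hI₃.1.2 a ha]
      funext x y
      exact if_neg fun hh => absurd hh.1 (by omega)
    · simp only [updateCell, true_and]
      split_ifs with h
      · obtain ⟨h1, h2⟩ := h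
        obtain rfl : i' = ⟨i, hi⟩ := Fin.ext h1
        obtain rfl : j' = ⟨j, hj⟩ := Fin.ext h2
        obtain ⟨h3, h4⟩ := hI₃.2.1 ⟨i, hi⟩ ⟨l, hl⟩
        obtain ⟨h5, h6⟩ := hI₃.2.1 ⟨l, hl⟩ ⟨j, hj⟩
        simp only [Memory.data_real] at h3 h4 h5 h6
        refine ⟨by linarith, ?_⟩
        -- Entries are non-negative, so one summand of at least `ρ` keeps the sum at least `ρ`.
        rcases h4 with h4 | ⟨p, hp⟩
        · left; linarith
        rcases h6 with h6 | ⟨p', hp'⟩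
        · left; linarith
        right
        refine ⟨p.append p', ?_⟩
        rw [EdgeWeightedGraph.length_append]
        push_cast
        linarith
      · exact hI₃.2.1 i' j'
    · exact (hcell i' j').trans (hI₃.2.2 i' j')
    · simp only [updateCell, and_self, if_true]
      exact add_le_add hil hlj
  · refine ⟨hI₃, fun _ _ => le_rfl, fun _ => ?_⟩
    simp only [Test.Holds, viaExpr, RealExpr.eval, counter_eval, hi₃, hl₃, hj₃] at hb
    simp only [Memory.data_real] at hil hlj ⊢
    linarith

/-- The step bound of `distProgram`. -/
def distTime (q : ℕ) : ℕ :=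
  (q * (q * 5 + 2 + 2) + 2) + (q * (q * (q * (q * 4 + 2 + 2) + 2 + 2) + 2 + 2) + 2)

/-- After `t` rounds all walks with at most `t + 1` edges are accounted for. Shortcutting a walk to
a path does not increase its length and leaves fewer than `n` edges. -/
theorem distProgram_runs {q : ℕ} (hq : n ≤ q) (hρ : 0 < ρ) :
    Runs 100 distProgram (inputMemory G T bag ρ) (distTime q)
      (fun d => KeepsInput (inputMemory G T bag ρ) d ∧ DistSound G ρ d ∧
        ∀ (i j : Fin n) (p : G.graph.Walk i j), d.real 2 i j ≤ G.length p) := by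
  refine Runs.seq (initDistProgram_runs hq le_rfl) fun s _ hs => ?_
  obtain ⟨hk, hD⟩ := hs
  refine (Runs.forLoop (K := n) (I := fun t d =>
    KeepsInput (inputMemory G T bag ρ) d ∧ DistSound G ρ d ∧
    ∀ (i j : Fin n) (p : G.graph.Walk i j), p.length ≤ t + 1 → d.real 2 i j ≤ G.length p)
    le_rfl hq (fun t d hd => by rw [hd.1.1]; rfl) ⟨hk, fun i j => ?_, fun i j p hp => ?_⟩
    fun t ht s' hs' hst hI => ?_).mono le_rfl fun d hd => ⟨hd.1, hd.2.1, fun i j p => ?_⟩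
  · rw [hD, startDist]
    split_ifs with h1 h2
    · subst h1
      exact ⟨le_rfl, Or.inr ⟨.nil, by simp⟩⟩
    · exact ⟨NNReal.coe_nonneg _, Or.inr ⟨.cons h2 .nil, by simp⟩⟩
    · exact ⟨hρ.le, Or.inl le_rfl⟩
  · rw [hD, startDist]
    cases p with
    | nil => simp
    | cons h p =>
      cases p with
      | nil => simp [h, h.ne]
      | cons h' p => simp at hp
  · refine (relaxRoundProgram_runs hq (by rfl) hI.1 hI.2.1).mono le_rfl fun d hd =>
      ⟨hd.1, hd.2.1, fun i j p hp => ?_⟩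
    cases p with
    | nil =>
      refine (hd.2.2 i i i).trans ?_
      have := hI.2.2 i i .nil (by simp)
      simp only [EdgeWeightedGraph.length_nil, NNReal.coe_zero] at this ⊢
      linarith
    | @cons _ l _ h p =>
      refine (hd.2.2 i l j).trans ?_
      have h1 := hI.2.2 i l (.cons h .nil) (by simp)
      have h2 := hI.2.2 l j p (by simpa using hp)
      simp only [EdgeWeightedGraph.length_cons, EdgeWeightedGraph.length_nil, NNReal.coe_add,
        add_zero] at h1 ⊢
      linarith
  · have h1 := hd.2.2 i j p.bypass (by
      have := p.bypass_isPath.length_lt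
      rw [Fintype.card_fin] at this
      omega)
    exact h1.trans (by exact_mod_cast G.length_bypass_le p)

end Dist

end

/-! ### Rounds of the covering -/

/-- The round in which the label `l` is given, if a round uses up to `n` labels. -/
def labelRound (n l : ℕ) : ℕ := (l - 1) / n

/-- The summand `1` in the label reserves `0` for unlabelled vertices. -/
theorem labelRound_eq {n : ℕ} (i : ℕ) (b : Fin n) : labelRound n (i * n + b + 1) = i := by
  rw [labelRound, Nat.add_sub_cancel, mul_comm, Nat.mul_add_div b.pos, Nat.div_eq_of_lt b.2,
    add_zero]

/-- The state of the labels after `j` rounds; unlabelled vertices have label `0`. -/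
structure PartialCovering {n : ℕ} {I : Type*} (H : SimpleGraph (Fin n))
    (near : Fin n → Fin n → Prop) (bag : I → Finset (Fin n)) (t : ℕ → I) (j : ℕ)
    (lab : Fin n → ℕ) : Prop where
  label : ∀ v, lab v ≠ 0 → ∃ i < j, ∃ b ∈ bag (t i), near b v ∧ lab v = i * n + b + 1
  covered : ∀ i < j, ∀ v ∈ bag (t i), lab v ≠ 0 ∧ labelRound n (lab v) ≤ i
  connected : ∀ v, lab v ≠ 0 → ∃ c ∈ bag (t (labelRound n (lab v))), ∃ p : H.Walk c v,
    ∀ z ∈ p.support, lab z ≠ 0 ∧ labelRound n (lab z) = labelRound n (lab v)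
  far : ∀ w w', H.Adj w w' → lab w ≠ 0 →
    (lab w' = 0 ∨ labelRound n (lab w) < labelRound n (lab w')) →
    ∀ b ∈ bag (t (labelRound n (lab w))), ¬ near b w'

namespace PartialCovering

variable {n : ℕ} {I : Type*} {H : SimpleGraph (Fin n)} {near : Fin n → Fin n → Prop}
  {bag : I → Finset (Fin n)} {t : ℕ → I} {j : ℕ} {lab : Fin n → ℕ}

theorem zero (t : ℕ → I) : PartialCovering H near bag t 0 (fun _ => 0) where
  label v hv := absurd rfl hv
  covered i hi := absurd hi (by omega)
  connected v hv := absurd rfl hv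
  far w w' _ hw := absurd rfl hw

theorem round_lt (C : PartialCovering H near bag t j lab) {v : Fin n} (hv : lab v ≠ 0) :
    labelRound n (lab v) < j := by
  obtain ⟨i, hi, b, -, -, h⟩ := C.label v hv
  rw [h, labelRound_eq]
  exact hi

/-- Only nodes before position `j` matter, so the sequence may be continued at will. -/
theorem congr (C : PartialCovering H near bag t j lab) {t' : ℕ → I}
    (ht : ∀ i < j, t' i = t i) : PartialCovering H near bag t' j lab where
  label v hv := by
    obtain ⟨i, hi, b, h⟩ := C.label v hv
    exact ⟨i, hi, b, by rwa [ht i hi]⟩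
  covered i hi := by rw [ht i hi]; exact C.covered i hi
  connected v hv := by rw [ht _ (C.round_lt hv)]; exact C.connected v hv
  far w w' h hw := by rw [ht _ (C.round_lt hw)]; exact C.far w w' h hw

/-- The set `S` is what round `j` covers. A neighbour of `S` that is covered later was unlabelled
and not put into `S`, so by `hclosed` it is not near the bag. For sets covered earlier, `far`
persists because it also speaks of unlabelled neighbours. -/
theorem step (C : PartialCovering H near bag t j lab) (S : Set (Fin n)) {lab' : Fin n → ℕ}
    (hseed : ∀ v ∈ bag (t j), lab v = 0 → v ∈ S)
    (hclosed : ∀ v ∈ S, ∀ w, H.Adj v w → lab w = 0 → (∃ b ∈ bag (t j), near b w) → w ∈ S)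
    (hsound : ∀ v ∈ S, lab v = 0 ∧ ∃ c ∈ bag (t j), ∃ p : H.Walk c v, ∀ z ∈ p.support, z ∈ S)
    (hnew : ∀ v ∈ S, ∃ b ∈ bag (t j), near b v ∧ lab' v = j * n + b + 1)
    (hold : ∀ v, v ∉ S → lab' v = lab v) : PartialCovering H near bag t (j + 1) lab' := by
  have hround : ∀ v ∈ S, lab' v ≠ 0 ∧ labelRound n (lab' v) = j := fun v hv => by
    obtain ⟨b, -, -, h⟩ := hnew v hv
    rw [h]
    exact ⟨by omega, labelRound_eq j b⟩
  have hlab : ∀ v, lab v ≠ 0 → lab' v = lab v := fun v hv =>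
    hold v fun hvS => hv (hsound v hvS).1
  refine ⟨fun v hv => ?_, fun i hi v hv => ?_, fun v hv => ?_, fun w w' hww' hw hw' => ?_⟩
  · by_cases hvS : v ∈ S
    · obtain ⟨b, hb⟩ := hnew v hvS
      exact ⟨j, by omega, b, hb⟩
    · rw [hold v hvS] at hv ⊢
      obtain ⟨i, hi, h⟩ := C.label v hv
      exact ⟨i, by omega, h⟩
  · by_cases hvS : v ∈ S
    · rw [(hround v hvS).2]
      refine ⟨(hround v hvS).1, ?_⟩
      by_contra hcon
      exact (C.covered i (by omega) v hv).1 (hsound v hvS).1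
    · rw [hold v hvS]
      rcases Nat.lt_succ_iff_lt_or_eq.1 hi with hi' | rfl
      · exact C.covered i hi' v hv
      · have h0 : lab v ≠ 0 := fun h => hvS (hseed v hv h)
        exact ⟨h0, (C.round_lt h0).le⟩
  · by_cases hvS : v ∈ S
    · obtain ⟨-, c, hc, p, hp⟩ := hsound v hvS
      rw [(hround v hvS).2]
      exact ⟨c, hc, p, fun z hz => hround z (hp z hz)⟩
    · rw [hold v hvS] at hv ⊢
      obtain ⟨c, hc, p, hp⟩ := C.connected v hv
      refine ⟨c, hc, p, fun z hz => ?_⟩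
      rw [hlab z (hp z hz).1]
      exact hp z hz
  · by_cases hwS : w ∈ S
    · rw [(hround w hwS).2] at hw' ⊢
      have hw'S : w' ∉ S := fun h => by
        have := hround w' h
        omega
      rw [hold w' hw'S] at hw'
      have h0 : lab w' = 0 := by
        by_contra h0
        have := C.round_lt h0
        omega
      exact fun b hb hbw => hw'S (hclosed w hwS w' hww' h0 ⟨b, hb, hbw⟩)
    · rw [hold w hwS] at hw hw' ⊢
      refine C.far w w' hww' hw ?_
      by_cases h0 : lab w' = 0
      · exact Or.inl h0
      · rw [hlab w' h0] at hw'
        exact hw'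

end PartialCovering

/-! ### The search of the tree, step by step -/

/-- The state of the search of the tree after `j` steps. -/
structure PartialSearch {m : ℕ} (T : SimpleGraph (Fin m)) (t : ℕ → Fin m) (j : ℕ) : Prop where
  inj : ∀ i < j, ∀ i' < j, t i = t i' → i = i'
  adj : ∀ i < j, i ≠ 0 → ∃ l < i, T.Adj (t l) (t i)
  start : j ≠ 0 → (t 0 : ℕ) = 0

namespace PartialSearch

variable {m : ℕ} {T : SimpleGraph (Fin m)} {t : ℕ → Fin m} {j : ℕ}

theorem zero (t : ℕ → Fin m) : PartialSearch T t 0 :=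
  ⟨fun i hi => absurd hi (by omega), fun i hi => absurd hi (by omega), fun h => absurd rfl h⟩

/-- Some node is unvisited by counting, and a walk to it from a visited node leaves the visited set
along an edge. -/
theorem exists_next (h : PartialSearch T t j) (hT : T.Connected) (hj : j < m) :
    ∃ s : Fin m, (∀ i < j, t i ≠ s) ∧ ((s : ℕ) = 0 ∨ ∃ i < j, T.Adj (t i) s) := by
  by_cases h0 : j = 0
  · subst h0
    exact ⟨⟨0, hj⟩, by simp, Or.inl rfl⟩
  have : ∃ s : Fin m, s ∉ (Finset.range j).image t := by
    by_contra hcon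
    push Not at hcon
    have h1 := Finset.card_le_card (fun s _ => hcon s : (Finset.univ : Finset (Fin m)) ⊆ _)
    have h2 := h1.trans Finset.card_image_le
    simp only [Finset.card_univ, Fintype.card_fin, Finset.card_range] at h2
    omega
  obtain ⟨s, hs⟩ := this
  obtain ⟨p⟩ := hT.preconnected (t 0) s
  obtain ⟨x, -, y, hxy, hx, hy⟩ := p.exists_entering_adj {s | s ∉ (Finset.range j).image t}
    (by simpa using ⟨0, by omega, rfl⟩) hs
  simp only [Set.mem_ofPred_eq, Finset.mem_image, Finset.mem_range, not_not] at hx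
  obtain ⟨i, hi, rfl⟩ := hx
  exact ⟨y, fun l hl hly => hy (Finset.mem_image.2 ⟨l, Finset.mem_range.2 hl, hly⟩),
    Or.inr ⟨i, hi, hxy⟩⟩

theorem step (h : PartialSearch T t j) {s : Fin m} (hs : ∀ i < j, t i ≠ s)
    (hadj : (s : ℕ) = 0 ∨ ∃ i < j, T.Adj (t i) s) :
    PartialSearch T (Function.update t j s) (j + 1) := by
  have hlt : ∀ i < j, Function.update t j s i = t i := fun i hi =>
    Function.update_of_ne hi.ne _ _
  refine ⟨fun i hi i' hi' hii' => ?_, fun i hi hi0 => ?_, fun _ => ?_⟩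
  · rcases Nat.lt_succ_iff_lt_or_eq.1 hi with hi | rfl <;>
      rcases Nat.lt_succ_iff_lt_or_eq.1 hi' with hi' | rfl
    · rw [hlt i hi, hlt i' hi'] at hii'
      exact h.inj i hi i' hi' hii'
    · rw [hlt i hi, Function.update_self] at hii'
      exact absurd hii' (hs i hi)
    · rw [hlt i' hi', Function.update_self] at hii'
      exact absurd hii'.symm (hs i' hi')
    · rfl
  · rcases Nat.lt_succ_iff_lt_or_eq.1 hi with hi | rfl
    · obtain ⟨l, hl, h'⟩ := h.adj i hi hi0
      exact ⟨l, hl, by rwa [hlt i hi, hlt l (hl.trans hi)]⟩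
    -- Node `0` was taken first, so a later new node has a visited neighbour.
    · rcases hadj with hadj | ⟨l, hl, hadj⟩
      · exact absurd (Fin.ext ((h.start hi0).trans hadj.symm)) (hs 0 (by omega))
      · exact ⟨l, hl, by rwa [hlt l hl, Function.update_self]⟩
  · by_cases h0 : j = 0
    · subst h0
      rw [Function.update_self]
      simpa using hadj
    · rw [hlt 0 (by omega)]
      exact h.start h0

theorem isSearchOrder (h : PartialSearch T t m) : IsSearchOrder T m t where
  inj := h.inj
  surj s := by
    have hinj : Function.Injective fun i : Fin m => t i := fun i i' hii' =>
      Fin.ext (h.inj i i.2 i' i'.2 hii')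
    obtain ⟨i, hi⟩ := (Finite.injective_iff_surjective.1 hinj) s
    exact ⟨i, i.2, hi⟩
  adj := h.adj

end PartialSearch

/-! ### From the finished covering to the partition -/

/-- When all rounds are over, the labels describe a partition as required. -/
theorem PartialCovering.exists_partition {n m : ℕ} {G : EdgeWeightedGraph (Fin n)}
    {T : SimpleGraph (Fin m)} {bag : Fin m → Finset (Fin n)} {ρ : ℝ} (hρ : 0 < ρ)
    (hT : IsTreeDecomposition G.graph T bag) {t : ℕ → Fin m} (ht : PartialSearch T t m)
    {near : Fin n → Fin n → Prop} (hnear : ∀ u v, ∀ p : G.graph.Walk u v,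
      (G.length p : ℝ) ≤ ρ / 2 → near u v)
    (hdist : ∀ b u v, near b u → near b v → G.dist u v ≤ ENNReal.ofReal ρ) {lab : Fin n → ℕ}
    (C : PartialCovering G.graph near bag t m lab) :
    ∃ (P : Finpartition (Finset.univ : Finset (Fin n))) (le : P.parts → P.parts → Prop),
      IsLinearOrder P.parts le ∧
      (∀ X Y : P.parts, ∀ u ∈ X.1, ∀ v ∈ Y.1, (le X Y ↔ lab u ≤ lab v)) ∧
      (∀ X ∈ P.parts, G.weakDiam (X : Set (Fin n)) ≤ ENNReal.ofReal ρ) ∧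
      ∀ k : ℕ, (∀ t, (bag t).card ≤ k) → ∀ r : ℝ, ρ < r →
        G.wcol r P le ≤
          min (k * 2 ^ k * Nat.choose (k + ⌈2 * (r / ρ)⌉₊) k)
            ((2 * ⌈2 * r / ρ⌉₊ + k + 1) ^ (3 * ⌈2 * r / ρ⌉₊ + 4)) := by
  have hso := ht.isSearchOrder
  have hlab0 : ∀ v, lab v ≠ 0 := fun v => by
    obtain ⟨⟨s, hs⟩⟩ := (hT.connected v).nonempty
    obtain ⟨i, hi, rfl⟩ := hso.surj s
    exact (C.covered i hi v hs).1
  have hbag : ∀ i < m, bagSeq bag m t i = bag (t i) := fun i hi => if_pos hi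
  have hlt : ∀ v, labelRound n (lab v) < m := fun v => C.round_lt (hlab0 v)
  choose i hi β hβ hβn hβlab using fun v => C.label v (hlab0 v)
  have hround : ∀ v, labelRound n (lab v) = i v := fun v => by rw [hβlab, labelRound_eq]
  have hcov := hT.bagCovering hso (h := ρ / 2) (by positivity)
    (σ := fun v => labelRound n (lab v))
    (fun j v hv => by
      by_cases hj : j < m
      · rw [hbag j hj] at hv
        exact (C.covered j hj v hv).2
      · rw [bagSeq, if_neg hj] at hv
        simp at hv)
    (fun v => by
      rw [hbag _ (hlt v)]
      obtain ⟨c, hc, p, hp⟩ := C.connected v (hlab0 v)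
      exact ⟨c, hc, p, fun z hz => (hp z hz).2⟩)
    (fun w w' hww' hσ b hb p => by
      rw [hbag _ (hlt w)] at hb
      by_contra hcon
      exact C.far w w' hww' (hlab0 w) (Or.inr hσ) b hb (hnear b w' p (not_lt.1 hcon)))
  obtain ⟨P, le, h1, h2, h3, h4⟩ := hcov.exists_partition lab
    (fun u v huv => Nat.div_le_div_right (Nat.sub_le_sub_right huv 1)) β
    (fun v => by rw [hbag _ (hlt v), hround]; exact hβ v)
    (fun u v huv hb => by
      rw [hround, hround] at huv
      rw [hβlab u, hβlab v, huv, hb])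
    (ρ := ρ) (by ring)
    (fun u v huv => by
      -- A label encodes its round and its bag vertex, so vertices with equal labels are near the
      -- same vertex.
      have h1 : i u = i v := by rw [← hround, ← hround, huv]
      have h2 : β u = β v := by
        have := hβlab u
        rw [huv, hβlab v, h1] at this
        exact Fin.ext (by omega)
      exact hdist (β u) u v (hβn u) (h2 ▸ hβn v))
  refine ⟨P, le, h1, h2, h3, fun k hk r hr => h4 k (fun j => ?_) r hr⟩
  rw [bagSeq]
  split_ifs
  · exact hk _
  · simp

/-! ### Programs that only raise flags -/

noncomputable section

/-- Only the `a`-th array of natural numbers has been changed. -/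
def SameExcept (a : ℕ) (d d' : Memory) : Prop :=
  (∀ b ≠ a, d'.nat b = d.nat b) ∧ d'.real = d.real

namespace SameExcept

variable {a : ℕ} {d d' d'' : Memory}

theorem refl (a : ℕ) (d : Memory) : SameExcept a d d := ⟨fun _ _ => rfl, rfl⟩

theorem trans (h : SameExcept a d d') (h' : SameExcept a d' d'') : SameExcept a d d'' :=
  ⟨fun b hb => (h'.1 b hb).trans (h.1 b hb), h'.2.trans h.2⟩

theorem update (a : ℕ) (d : Memory) (i j x : ℕ) :
    SameExcept a d { d with nat := updateCell d.nat a i j x } :=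
  ⟨fun b hb => by
    funext i' j'
    exact if_neg fun hh => hb hh.1, rfl⟩

end SameExcept

theorem updateCell_same (f : ℕ → ℕ → ℕ → ℕ) (a i j x i' j' : ℕ) :
    updateCell f a i j x a i' j' = if i' = i ∧ j' = j then x else f a i' j' := by
  simp [updateCell]

/-- The program makes exactly the cells `(y, z)` of the array `a` with `R y z` positive. -/
def Flags (c : ℕ) (p : Program) (s : Memory) (T a : ℕ) (R : ℕ → ℕ → Prop) : Prop :=
  Runs c p s T fun d => SameExcept a s.data d ∧
    ∀ y z, 1 ≤ d.nat a y z ↔ 1 ≤ s.data.nat a y z ∨ R y z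

namespace Flags

variable {c T a : ℕ} {p : Program} {s : Memory}

theorem ifThen {b : Test} {e₁ e₂ : NatExpr} {P : Prop} (ha : a < 100) {i j : ℕ}
    (hb : b.Holds s ↔ P) (h₁ : e₁.eval s = i) (h₂ : e₂.eval s = j) :
    Flags c (.ite b (.setNat a e₁ e₂ (.const 1)) .skip) s 2 a fun y z => P ∧ y = i ∧ z = j := by
  refine Runs.ifThen (fun hs => Runs.setNat ha ⟨SameExcept.update _ _ _ _ _, fun y z => ?_⟩)
    fun hs => ⟨SameExcept.refl _ _, fun y z => ?_⟩
  · simp only [updateCell_same, h₁, h₂, NatExpr.eval, hb.1 hs, true_and]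
    split_ifs with h <;> simp [h]
  · simp [mt hb.2 hs]

theorem forLoop {x K q : ℕ} {R : ℕ → ℕ → ℕ → Prop} (hc : 100 ≤ c) (ha : a ≠ 0) (hKq : K ≤ q)
    (hK : s.data.nat 0 0 x = K)
    (hstep : ∀ i < K, ∀ s', (∀ a, 100 ≤ a → a < c → s'.nat a = s.nat a) → s'.nat c 0 0 = i →
      SameExcept a s.data s'.data → Flags (c + 1) p s' T a (R i)) :
    Flags c (forLoop c x p) s (q * (T + 2) + 2) a fun y z => ∃ i < K, R i y z := by
  refine Runs.forLoop (I := fun i d => SameExcept a s.data d ∧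
    ∀ y z, 1 ≤ d.nat a y z ↔ 1 ≤ s.data.nat a y z ∨ ∃ i' < i, R i' y z) hc hKq
    (fun i d hd => by rw [hd.1.1 0 ha.symm, hK]) ⟨SameExcept.refl _ _, by simp⟩
    fun i hi s' hs' hci hI => ?_
  refine (hstep i hi s' hs' hci hI.1).mono le_rfl fun d hd => ⟨hI.1.trans hd.1, fun y z => ?_⟩
  rw [hd.2, hI.2, or_assoc]
  refine or_congr_right ⟨?_, ?_⟩
  · rintro (⟨i', hi', h⟩ | h)
    · exact ⟨i', by omega, h⟩
    · exact ⟨i, by omega, h⟩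
  · rintro ⟨i', hi', h⟩
    rcases Nat.lt_succ_iff_lt_or_eq.1 hi' with hi' | rfl
    · exact Or.inl ⟨i', hi', h⟩
    · exact Or.inr h

end Flags

/-! ### One round of the covering

The counter `100` is the round. The arrays are: `4` the labels, `5` the nodes visited so far, `6`
their neighbours and the first node, `7` the selected node, `8` the vertices near its bag, `9` the
vertices to be covered, `10` the number of labels in use. -/

def zeroExpr : NatExpr := .const 0

def selected : NatExpr := .get 7 zeroExpr zeroExpr

def bagTest (c : ℕ) : Test := .natLE (.const 1) (.get 3 selected (counter c))

def nearTest (c c' : ℕ) : Test :=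
  .realLE (.add (.get 2 (counter c) (counter c')) (.get 2 (counter c) (counter c'))) boundExpr

def unlabelledTest (c : ℕ) : Test := .natLE (.get 4 (counter c) zeroExpr) zeroExpr

/-- Each candidate overwrites the previous one; any unvisited candidate will do. -/
def selectProgram : Program :=
  forLoop 101 1 (.ite (.and (.natLE (.get 5 (counter 101) zeroExpr) zeroExpr)
    (.natLE (.const 1) (.get 6 (counter 101) zeroExpr)))
    (.setNat 7 zeroExpr zeroExpr (counter 101)) .skip)

def neighbourProgram : Program :=
  forLoop 101 1 (.ite (.natLE (.const 1) (.get 2 selected (counter 101)))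
    (.setNat 6 (counter 101) zeroExpr (.const 1)) .skip)

/-- Every round has its own row in the arrays `8` and `9`, so no flags need to be cleared. -/
def ballProgram : Program :=
  forLoop 101 0 (forLoop 102 0 (.ite (.and (bagTest 101) (nearTest 101 102))
    (.setNat 8 (counter 100) (counter 102) (.const 1)) .skip))

def seedProgram : Program :=
  forLoop 101 0 (.ite (.and (bagTest 101) (unlabelledTest 101))
    (.setNat 9 (counter 100) (counter 101) (.const 1)) .skip)

def closeTest : Test :=
  .and (.and (.natLE (.const 1) (.get 9 (counter 100) (counter 102)))
    (.natLE (.const 1) (.get 1 (counter 102) (counter 103))))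
    (.and (.natLE (.const 1) (.get 8 (counter 100) (counter 103))) (unlabelledTest 103))

def closeRoundProgram : Program :=
  forLoop 102 0 (forLoop 103 0 (.ite closeTest
    (.setNat 9 (counter 100) (counter 103) (.const 1)) .skip))

def closeProgram : Program := forLoop 101 0 closeRoundProgram

def labelTest : Test :=
  .and (.and (.natLE (.const 1) (.get 9 (counter 100) (counter 102))) (unlabelledTest 102))
    (.and (bagTest 101) (nearTest 101 102))

/-- The cell of array `10` advances for every vertex, whether in the bag or not, so in round `j` it
holds `j * n + b + 1` while `b` is considered. The test for label `0` makes the first suitable `b`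
win. -/
def labelProgram : Program :=
  forLoop 101 0 (.seq
    (.setNat 10 zeroExpr zeroExpr (.add (.get 10 zeroExpr zeroExpr) (.const 1)))
    (forLoop 102 0 (.ite labelTest
      (.setNat 4 (counter 102) zeroExpr (.get 10 zeroExpr zeroExpr)) .skip)))

section Round

variable {n m : ℕ} {s : Memory} {q : ℕ}

theorem selectProgram_runs (hq : m ≤ q) (hm : s.data.nat 0 0 1 = m)
    (hex : ∃ x < m, s.data.nat 5 x 0 = 0 ∧ 1 ≤ s.data.nat 6 x 0) :
    Runs 101 selectProgram s (q * 4 + 2) fun d => SameExcept 7 s.data d ∧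
      d.nat 7 0 0 < m ∧ s.data.nat 5 (d.nat 7 0 0) 0 = 0 ∧ 1 ≤ s.data.nat 6 (d.nat 7 0 0) 0 := by
  refine (Runs.forLoop (K := m) (T := 2) (I := fun i d => SameExcept 7 s.data d ∧
    ((∃ x < i, s.data.nat 5 x 0 = 0 ∧ 1 ≤ s.data.nat 6 x 0) → d.nat 7 0 0 < m ∧
      s.data.nat 5 (d.nat 7 0 0) 0 = 0 ∧ 1 ≤ s.data.nat 6 (d.nat 7 0 0) 0)) (by norm_num) hq
    (fun i d hd => by rw [hd.1.1 0 (by norm_num), hm]) ⟨SameExcept.refl _ _, by simp⟩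
    fun i hi s' hs' hci hI => ?_).mono le_rfl fun d hd => ⟨hd.1, hd.2 hex⟩
  have h5 : s'.nat 5 = s.data.nat 5 := by
    rw [← hI.1.1 5 (by norm_num), Memory.data_nat _ (by norm_num)]
  have h6 : s'.nat 6 = s.data.nat 6 := by
    rw [← hI.1.1 6 (by norm_num), Memory.data_nat _ (by norm_num)]
  refine Runs.ifThen (fun hb => Runs.setNat (by norm_num)
    ⟨hI.1.trans (SameExcept.update _ _ _ _ _), fun _ => ?_⟩) fun hb => ⟨hI.1, ?_⟩
  · simp only [Test.Holds, NatExpr.eval, counter_eval, hci, zeroExpr, h5, h6] at hb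
    simp only [updateCell_same, NatExpr.eval, counter_eval, hci, zeroExpr, and_self, if_true]
    exact ⟨hi, by omega, hb.2⟩
  · simp only [Test.Holds, NatExpr.eval, counter_eval, hci, zeroExpr, h5, h6] at hb
    rintro ⟨x, hx, hx'⟩
    rcases Nat.lt_succ_iff_lt_or_eq.1 hx with hx | rfl
    · exact hI.2 ⟨x, hx, hx'⟩
    · exact absurd ⟨hx'.1.le, hx'.2⟩ hb

theorem neighbourProgram_flags (hq : m ≤ q) (hm : s.data.nat 0 0 1 = m) :
    Flags 101 neighbourProgram s (q * 4 + 2) 6 fun y z => ∃ i < m,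
      1 ≤ s.data.nat 2 (s.data.nat 7 0 0) i ∧ y = i ∧ z = 0 := by
  refine Flags.forLoop (T := 2) (by norm_num) (by norm_num) hq hm fun i hi s' hs' hci hI => ?_
  refine Flags.ifThen (by norm_num) ?_ (by simp [hci]) rfl
  have h2 := hI.1 2 (by norm_num)
  have h7 := hI.1 7 (by norm_num)
  rw [Memory.data_nat _ (by norm_num)] at h2 h7
  simp [Test.Holds, NatExpr.eval, selected, zeroExpr, hci, h2, h7]

theorem bagTest_holds {c i : ℕ} (hc : s.nat c 0 0 = i) :
    (bagTest c).Holds s ↔ 1 ≤ s.data.nat 3 (s.data.nat 7 0 0) i := by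
  rw [Memory.data_nat _ (by norm_num), Memory.data_nat _ (by norm_num)]
  simp [bagTest, Test.Holds, NatExpr.eval, selected, zeroExpr, hc]

theorem nearTest_holds {c c' i i' : ℕ} (hc : s.nat c 0 0 = i) (hc' : s.nat c' 0 0 = i') :
    (nearTest c c').Holds s ↔ s.data.real 2 i i' + s.data.real 2 i i' ≤ s.data.real 1 0 0 := by
  simp [nearTest, Test.Holds, RealExpr.eval, NatExpr.eval, boundExpr, hc, hc']

theorem unlabelledTest_holds {c i : ℕ} (hc : s.nat c 0 0 = i) :
    (unlabelledTest c).Holds s ↔ s.data.nat 4 i 0 = 0 := by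
  rw [Memory.data_nat _ (by norm_num)]
  simp [unlabelledTest, Test.Holds, NatExpr.eval, zeroExpr, hc]

theorem ballProgram_flags (hq : n ≤ q) (hn : s.data.nat 0 0 0 = n) {j : ℕ}
    (hj : s.nat 100 0 0 = j) :
    Flags 101 ballProgram s (q * (q * 4 + 2 + 2) + 2) 8 fun y z => ∃ b < n, ∃ v < n,
      (1 ≤ s.data.nat 3 (s.data.nat 7 0 0) b ∧
        s.data.real 2 b v + s.data.real 2 b v ≤ s.data.real 1 0 0) ∧ y = j ∧ z = v := by
  refine Flags.forLoop (by norm_num) (by norm_num) hq hn fun b hb s₁ hs₁ hb₁ hI₁ => ?_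
  refine Flags.forLoop (T := 2) (by norm_num) (by norm_num) hq
    (by rw [hI₁.1 0 (by norm_num), hn]) fun v hv s₂ hs₂ hv₂ hI₂ => ?_
  have hI := hI₁.trans hI₂
  have hb₂ : s₂.nat 101 0 0 = b := by rw [hs₂ 101 (by norm_num) (by norm_num), hb₁]
  have hj₂ : s₂.nat 100 0 0 = j := by
    rw [hs₂ 100 (by norm_num) (by norm_num), hs₁ 100 (by norm_num) (by norm_num), hj]
  refine Flags.ifThen (by norm_num) ?_ hj₂ hv₂
  rw [Test.Holds, bagTest_holds hb₂, nearTest_holds hb₂ hv₂, hI.2, hI.1 3 (by norm_num),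
    hI.1 7 (by norm_num)]

theorem seedProgram_flags (hq : n ≤ q) (hn : s.data.nat 0 0 0 = n) {j : ℕ}
    (hj : s.nat 100 0 0 = j) :
    Flags 101 seedProgram s (q * 4 + 2) 9 fun y z => ∃ v < n,
      (1 ≤ s.data.nat 3 (s.data.nat 7 0 0) v ∧ s.data.nat 4 v 0 = 0) ∧ y = j ∧ z = v := by
  refine Flags.forLoop (T := 2) (by norm_num) (by norm_num) hq hn fun v hv s₁ hs₁ hv₁ hI => ?_
  have hj₁ : s₁.nat 100 0 0 = j := by rw [hs₁ 100 (by norm_num) (by norm_num), hj]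
  refine Flags.ifThen (by norm_num) ?_ hj₁ hv₁
  rw [Test.Holds, bagTest_holds hv₁, unlabelledTest_holds hv₁, hI.1 3 (by norm_num),
    hI.1 7 (by norm_num), hI.1 4 (by norm_num)]

end Round

/-! ### Spreading the marks of a round -/

section Closure

variable {n : ℕ} {H : SimpleGraph (Fin n)} {q : ℕ}

/-- The unlabelled vertices in the ball of round `j`. -/
def Allowed (d : Memory) (j : ℕ) (v : ℕ) : Prop := 1 ≤ d.nat 8 j v ∧ d.nat 4 v 0 = 0

/-- The vertices reachable from the marked ones through unlabelled vertices in the ball. -/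
def ReachableFromMarked (H : SimpleGraph (Fin n)) (d : Memory) (j : ℕ) (w : Fin n) : Prop :=
  ∃ c : Fin n, 1 ≤ d.nat 9 j c ∧ ∃ p : H.Walk w c, ∀ z ∈ p.support, Allowed d j z

/-- The marks of round `j` have been extended, but only to reachable vertices. -/
def ExtendsMarks (H : SimpleGraph (Fin n)) (d₀ d : Memory) (j : ℕ) : Prop :=
  SameExcept 9 d₀ d ∧ (∀ y ≠ j, d.nat 9 y = d₀.nat 9 y) ∧
    ∀ w : Fin n, 1 ≤ d.nat 9 j w → ReachableFromMarked H d₀ j w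

/-- A new mark prolongs the walk of a marked neighbour. Marks may travel several edges within one
pass, which is harmless since only reachability is claimed. -/
theorem closeRoundProgram_runs (hq : n ≤ q) {j : ℕ} {d₀ s : Memory} (hj : s.nat 100 0 0 = j)
    (hn : d₀.nat 0 0 0 = n) (hadj : ∀ u v : Fin n, 1 ≤ d₀.nat 1 u v ↔ H.Adj u v)
    (hs : ExtendsMarks H d₀ s.data j) :
    Runs 102 closeRoundProgram s (q * (q * 4 + 2 + 2) + 2) fun d => ExtendsMarks H d₀ d j ∧
      (∀ v : Fin n, 1 ≤ s.data.nat 9 j v → 1 ≤ d.nat 9 j v) ∧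
      ∀ v w : Fin n, H.Adj v w → 1 ≤ s.data.nat 9 j v → Allowed d₀ j w → 1 ≤ d.nat 9 j w := by
  set Inv : Memory → Prop := fun d => ExtendsMarks H d₀ d j ∧
    ∀ v : Fin n, 1 ≤ s.data.nat 9 j v → 1 ≤ d.nat 9 j v with hInv
  set Le : Memory → Memory → Prop := fun d d' =>
    ∀ v : Fin n, 1 ≤ d.nat 9 j v → 1 ≤ d'.nat 9 j v with hLe
  have hN : ∀ d, Inv d → d.nat 0 0 0 = n := fun d hd => by rw [hd.1.1.1 0 (by norm_num), hn]
  have hrefl : ∀ d, Le d d := fun _ _ h => h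
  have htrans : ∀ d₁ d₂ d₃, Le d₁ d₂ → Le d₂ d₃ → Le d₁ d₃ :=
    fun _ _ _ h h' v hv => h' v (h v hv)
  refine (Runs.forLoop_mono (Inv := Inv) (Le := Le)
    (Φ := fun v d => ∀ (hv : v < n) (w : Fin n), H.Adj ⟨v, hv⟩ w → 1 ≤ s.data.nat 9 j v →
      Allowed d₀ j w → 1 ≤ d.nat 9 j w)
    (by norm_num) hq hN hrefl htrans
    (fun v d d' hle h hv w h1 h2 h3 => hle w (h hv w h1 h2 h3))
    ⟨hs, fun _ h => h⟩ fun v hv s₁ hs₁ hv₁ hI₁ => ?_).mono le_rfl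
    fun d hd => ⟨hd.1.1, hd.1.2, fun v w => hd.2.2 v v.2 v.2 w⟩
  refine (Runs.forLoop_mono (Inv := Inv) (Le := Le) (T := 2)
    (Φ := fun w d => ∀ hw : w < n, H.Adj ⟨v, hv⟩ ⟨w, hw⟩ → 1 ≤ s.data.nat 9 j v →
      Allowed d₀ j w → 1 ≤ d.nat 9 j w)
    (by norm_num) hq hN hrefl htrans
    (fun w d d' hle h hw h1 h2 h3 => hle ⟨w, hw⟩ (h hw h1 h2 h3))
    hI₁ fun w hw s₂ hs₂ hw₂ hI₂ => ?_).mono le_rfl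
    fun d hd => ⟨hd.1, hd.2.1, fun _ w => hd.2.2 w w.2 w.2⟩
  have hv₂ : s₂.nat 102 0 0 = v := by rw [hs₂ 102 (by norm_num) (by norm_num), hv₁]
  have hj₂ : s₂.nat 100 0 0 = j := by
    rw [hs₂ 100 (by norm_num) (by norm_num), hs₁ 100 (by norm_num) (by norm_num), hj]
  replace hw₂ : s₂.nat 103 0 0 = w := hw₂
  obtain ⟨⟨hsame, hrows, hreach⟩, hext⟩ := hI₂
  have htest : closeTest.Holds s₂ ↔ (1 ≤ s₂.data.nat 9 j v ∧ H.Adj ⟨v, hv⟩ ⟨w, hw⟩) ∧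
      Allowed d₀ j w := by
    have hu := unlabelledTest_holds hw₂
    rw [Memory.data_nat _ (by norm_num)] at hu
    rw [Allowed, ← hadj ⟨v, hv⟩ ⟨w, hw⟩, ← hsame.1 4 (by norm_num), ← hsame.1 8 (by norm_num),
      ← hsame.1 1 (by norm_num), Memory.data_nat _ (by norm_num), Memory.data_nat _ (by norm_num),
      Memory.data_nat _ (by norm_num), Memory.data_nat _ (by norm_num)]
    simp only [closeTest, Test.Holds, hu, NatExpr.eval, counter_eval, hj₂, hv₂, hw₂]
  refine Runs.ifThen (fun hb => Runs.setNat (by norm_num) ?_) fun hb =>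
    ⟨⟨⟨hsame, hrows, hreach⟩, hext⟩, fun _ h => h, fun hw h1 h2 h3 => ?_⟩
  · obtain ⟨⟨hvm, hvw⟩, hwa⟩ := htest.1 hb
    simp only [counter_eval, hj₂, hw₂, NatExpr.eval]
    have hle : Le s₂.data { s₂.data with nat := updateCell s₂.data.nat 9 j w 1 } := by
      intro x hx
      simp only [updateCell_same]
      split_ifs
      · exact le_rfl
      · exact hx
    refine ⟨⟨⟨hsame.trans (SameExcept.update _ _ _ _ _), fun y hy => ?_, fun x hx => ?_⟩,
      fun x hx => hle x (hext x hx)⟩, hle, fun _ _ _ _ => ?_⟩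
    · rw [← hrows y hy]
      funext z
      simp only [updateCell_same]
      exact if_neg fun h => hy h.1
    · simp only [updateCell_same, true_and] at hx
      split_ifs at hx with hxw
      · obtain rfl : x = ⟨w, hw⟩ := Fin.ext hxw
        obtain ⟨c, hc, p, hp⟩ := hreach ⟨v, hv⟩ hvm
        refine ⟨c, hc, .cons hvw.symm p, fun z hz => ?_⟩
        rw [SimpleGraph.Walk.support_cons, List.mem_cons] at hz
        rcases hz with rfl | hz
        · exact hwa
        · exact hp z hz
      · exact hreach x hx
    · simp [updateCell_same]
  · by_contra hcon
    exact hb (htest.2 ⟨⟨hext ⟨v, hv⟩ h2, h1⟩, h3⟩)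

/-- After `t` passes every vertex with an allowed walk of at most `t` edges to an initial mark is
marked; paths have fewer than `n` edges. -/
theorem closeProgram_runs (hq : n ≤ q) {j : ℕ} {s : Memory} (hj : s.nat 100 0 0 = j)
    (hn : s.data.nat 0 0 0 = n) (hadj : ∀ u v : Fin n, 1 ≤ s.data.nat 1 u v ↔ H.Adj u v)
    (hseed : ∀ v : Fin n, 1 ≤ s.data.nat 9 j v → Allowed s.data j v) :
    Runs 101 closeProgram s (q * (q * (q * 4 + 2 + 2) + 2 + 2) + 2) fun d =>
      SameExcept 9 s.data d ∧ (∀ y ≠ j, d.nat 9 y = s.data.nat 9 y) ∧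
        ∀ w : Fin n, 1 ≤ d.nat 9 j w ↔ ReachableFromMarked H s.data j w := by
  refine (Runs.forLoop (K := n) (I := fun t d => ExtendsMarks H s.data d j ∧
    ∀ w c : Fin n, 1 ≤ s.data.nat 9 j c → ∀ p : H.Walk w c, (∀ z ∈ p.support, Allowed s.data j z) →
      p.length ≤ t → 1 ≤ d.nat 9 j w) (by norm_num) hq
    (fun t d hd => by rw [hd.1.1.1 0 (by norm_num), hn]) ⟨⟨SameExcept.refl _ _, fun _ _ => rfl,
      fun w hw => ⟨w, hw, .nil, by simpa using hseed w hw⟩⟩, fun w c hc p _ hp => ?_⟩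
    fun t ht s' hs' hst hI => ?_).mono le_rfl fun d hd => ⟨hd.1.1, hd.1.2.1, fun w =>
      ⟨hd.1.2.2 w, fun ⟨c, hc, p, hp⟩ => ?_⟩⟩
  · obtain rfl := SimpleGraph.Walk.eq_of_length_eq_zero (by omega : p.length = 0)
    exact hc
  · refine (closeRoundProgram_runs hq (by rw [hs' 100 (by norm_num) (by norm_num), hj]) hn hadj
      hI.1).mono le_rfl fun d hd => ⟨hd.1, fun w c hc p hp hlen => ?_⟩
    cases p with
    | nil => exact hd.2.1 _ (hI.2 w w hc .nil hp (by simp))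
    | @cons _ v _ h p =>
      refine hd.2.2 v w h.symm (hI.2 v c hc p (fun z hz => hp z ?_) (by simpa using hlen))
        (hp w (SimpleGraph.Walk.start_mem_support _))
      rw [SimpleGraph.Walk.support_cons]
      exact List.mem_cons_of_mem _ hz
  · refine hd.2 w c hc p.bypass (fun z hz => hp z (p.support_bypass_subset_support hz)) ?_
    have := p.bypass_isPath.length_lt
    rw [Fintype.card_fin] at this
    omega

end Closure


/-! ### Labelling the covered vertices -/

section Label

variable {n q : ℕ}

/-- The cell `(b, v)` says that the vertex `b` of the selected bag is near `v`. -/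
def NearSelected (d : Memory) (b v : ℕ) : Prop :=
  1 ≤ d.nat 3 (d.nat 7 0 0) b ∧ d.real 2 b v + d.real 2 b v ≤ d.real 1 0 0

/-- The vertex `v` is to be labelled in round `j`. -/
def IsPending (d : Memory) (j v : ℕ) : Prop := 1 ≤ d.nat 9 j v ∧ d.nat 4 v 0 = 0

/-- The label `l` of `v` when the first `B` vertices have been considered in round `j`. -/
def HasLabel (d : Memory) (j B v l : ℕ) : Prop :=
  (l = d.nat 4 v 0 ∧ ¬ (IsPending d j v ∧ ∃ b < B, NearSelected d b v)) ∨
    (IsPending d j v ∧ ∃ b < B, NearSelected d b v ∧ l = d.nat 10 0 0 + b + 1)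

/-- Only labels have been changed. -/
def SameExceptLabels (d d' : Memory) : Prop :=
  (∀ a, a ≠ 4 → a ≠ 10 → d'.nat a = d.nat a) ∧ d'.real = d.real

theorem HasLabel.succ {d : Memory} {j b v l : ℕ} (h : HasLabel d j b v l)
    (hb : ¬ (1 ≤ d.nat 9 j v ∧ l = 0 ∧ NearSelected d b v)) : HasLabel d j (b + 1) v l := by
  rcases h with ⟨hl, hn⟩ | ⟨hp, b', hb', h⟩
  · refine Or.inl ⟨hl, ?_⟩
    rintro ⟨hp, b', hb', h⟩
    rcases Nat.lt_succ_iff_lt_or_eq.1 hb' with hb' | rfl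
    · exact hn ⟨hp, b', hb', h⟩
    · exact hb ⟨hp.1, hl.trans hp.2, h⟩
  · exact Or.inr ⟨hp, b', by omega, h⟩

theorem labelProgram_runs (hq : n ≤ q) {j : ℕ} {s : Memory} (hj : s.nat 100 0 0 = j)
    (hn : s.data.nat 0 0 0 = n) :
    Runs 101 labelProgram s (q * (1 + (q * 4 + 2) + 2) + 2) fun d =>
      SameExceptLabels s.data d ∧ d.nat 10 0 0 = s.data.nat 10 0 0 + n ∧
        ∀ v < n, HasLabel s.data j n v (d.nat 4 v 0) := by
  refine Runs.forLoop (K := n) (I := fun b d => SameExceptLabels s.data d ∧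
    d.nat 10 0 0 = s.data.nat 10 0 0 + b ∧ ∀ v < n, HasLabel s.data j b v (d.nat 4 v 0))
    (by norm_num) hq (fun b d hd => by rw [hd.1.1 0 (by norm_num) (by norm_num), hn])
    ⟨⟨fun _ _ _ => rfl, rfl⟩, rfl, fun v _ => Or.inl ⟨rfl, by simp⟩⟩ fun b hb s₁ hs₁ hb₁ hI₁ => ?_
  obtain ⟨hsame, hcur, hlab⟩ := hI₁
  refine Runs.seq (Q := fun d => SameExceptLabels s.data d ∧
    d.nat 10 0 0 = s.data.nat 10 0 0 + (b + 1) ∧ ∀ v < n, HasLabel s.data j b v (d.nat 4 v 0))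
    (Runs.setNat (by norm_num) ?_) fun s₂ hs₂ hI₂ => ?_
  · have hc' : s₁.nat 10 0 0 = s.data.nat 10 0 0 + b := by
      rw [← hcur, Memory.data_nat s₁ (by norm_num)]
    refine ⟨⟨fun a h4 h10 => ?_, hsame.2⟩, ?_, fun v hv => ?_⟩
    · rw [← hsame.1 a h4 h10]
      exact (SameExcept.update 10 _ _ _ _).1 a h10
    · simp only [updateCell_same, NatExpr.eval, zeroExpr, and_self, if_true, hc']
      ring
    · have : (updateCell s₁.data.nat 10 (zeroExpr.eval s₁) (zeroExpr.eval s₁)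
          ((NatExpr.add (.get 10 zeroExpr zeroExpr) (.const 1)).eval s₁)) 4 v 0 =
          s₁.data.nat 4 v 0 := if_neg (by simp)
      simp only [this]
      exact hlab v hv
  refine (Runs.forLoop (K := n) (T := 2) (I := fun v' d => SameExceptLabels s.data d ∧
    d.nat 10 0 0 = s.data.nat 10 0 0 + (b + 1) ∧
    (∀ v < n, v < v' → HasLabel s.data j (b + 1) v (d.nat 4 v 0)) ∧
    ∀ v < n, v' ≤ v → HasLabel s.data j b v (d.nat 4 v 0))
    (by norm_num) hq (fun b d hd => by rw [hd.1.1 0 (by norm_num) (by norm_num), hn])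
    ⟨hI₂.1, hI₂.2.1, by simp, fun v hv _ => hI₂.2.2 v hv⟩ fun v hv s₃ hs₃ hv₃ hI₃ => ?_).mono le_rfl
    fun d hd => ⟨hd.1, hd.2.1, fun v hv => hd.2.2.1 v hv hv⟩
  obtain ⟨hsame, hcur, hdone, htodo⟩ := hI₃
  have hj₃ : s₃.nat 100 0 0 = j := by
    rw [hs₃ 100 (by norm_num) (by norm_num), hs₂ 100 (by norm_num) (by norm_num),
      hs₁ 100 (by norm_num) (by norm_num), hj]
  have hb₃ : s₃.nat 101 0 0 = b := by
    rw [hs₃ 101 (by norm_num) (by norm_num), hs₂ 101 (by norm_num) (by norm_num), hb₁]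
  have htest : labelTest.Holds s₃ ↔
      1 ≤ s.data.nat 9 j v ∧ s₃.data.nat 4 v 0 = 0 ∧ NearSelected s.data b v := by
    have hu := unlabelledTest_holds hv₃
    have hbag := bagTest_holds hb₃
    have hnear := nearTest_holds hb₃ hv₃
    rw [hsame.1 3 (by norm_num) (by norm_num), hsame.1 7 (by norm_num) (by norm_num)] at hbag
    rw [hsame.2] at hnear
    rw [NearSelected, ← hsame.1 9 (by norm_num) (by norm_num), Memory.data_nat s₃ (by norm_num)]
    simp only [labelTest, Test.Holds, hu, hbag, hnear, NatExpr.eval, counter_eval, hj₃, hv₃,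
      and_assoc]
  refine Runs.ifThen (fun ht => Runs.setNat (by norm_num) ?_) fun ht =>
    ⟨hsame, hcur, fun w hw hwv => ?_, fun w hw hwv => htodo w hw (by omega)⟩
  · obtain ⟨h9, h4, hN⟩ := htest.1 ht
    have hc' : s₃.nat 10 0 0 = s.data.nat 10 0 0 + (b + 1) := by
      rw [← hcur, Memory.data_nat s₃ (by norm_num)]
    simp only [NatExpr.eval, counter_eval, hv₃, zeroExpr, hc']
    refine ⟨⟨fun a ha4 ha10 => ?_, hsame.2⟩, ?_, fun w hw hwv => ?_, fun w hw hwv => ?_⟩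
    · rw [← hsame.1 a ha4 ha10]
      exact (SameExcept.update 4 _ _ _ _).1 a ha4
    · rw [← hcur]
      exact if_neg (by simp)
    · simp only [updateCell_same]
      split_ifs with h
      · obtain rfl := h.1
        refine Or.inr ⟨⟨h9, ?_⟩, b, by omega, hN, by ring⟩
        -- A label given earlier in this round would be positive, so the vertex still has its label
        -- from before the round.
        rcases htodo w hw le_rfl with h | ⟨-, b', -, -, h⟩
        · rw [← h.1, h4]
        · omega
      · exact hdone w hw (lt_of_le_of_ne (Nat.lt_succ_iff.1 hwv) fun e => h ⟨e, trivial⟩)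
    · simp only [updateCell_same]
      rw [if_neg fun e => absurd e.1 (by omega)]
      exact htodo w hw (by omega)
  · rcases Nat.lt_succ_iff_lt_or_eq.1 hwv with hwv | rfl
    · exact hdone w hw hwv
    · exact (htodo w hw le_rfl).succ (mt htest.2 ht)

end Label

/-! ### Assembling the rounds -/

def coverRoundProgram : Program :=
  .seq selectProgram (.seq (.setNat 5 selected zeroExpr (.const 1)) (.seq neighbourProgram
    (.seq ballProgram (.seq seedProgram (.seq closeProgram labelProgram)))))

def coverProgram : Program :=
  .seq (.setNat 6 zeroExpr zeroExpr (.const 1)) (forLoop 100 1 coverRoundProgram)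

section Cover

variable {n m : ℕ} {G : EdgeWeightedGraph (Fin n)} {T : SimpleGraph (Fin m)}
  {bag : Fin m → Finset (Fin n)} {ρ : ℝ} {R : ℕ → ℕ → ℕ → ℝ}

/-- Nearness according to the real arrays `R`. -/
def NearTable (R : ℕ → ℕ → ℕ → ℝ) (b v : Fin n) : Prop := R 2 b v + R 2 b v ≤ R 1 0 0

/-- The memory before round `j`, when the nodes `t i` with `i < j` have been visited. -/
structure CoverState (G : EdgeWeightedGraph (Fin n)) (T : SimpleGraph (Fin m))
    (bag : Fin m → Finset (Fin n)) (ρ : ℝ) (R : ℕ → ℕ → ℕ → ℝ) (j : ℕ) (d : Memory)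
    (t : ℕ → Fin m) : Prop where
  input : ∀ a < 4, d.nat a = (inputMemory G T bag ρ).nat a
  real : d.real = R
  used : d.nat 10 0 0 = j * n
  fresh : ∀ y, j ≤ y → ∀ z, ¬ 1 ≤ d.nat 8 y z ∧ ¬ 1 ≤ d.nat 9 y z
  search : PartialSearch T t j
  visited : ∀ x : Fin m, 1 ≤ d.nat 5 x 0 ↔ ∃ i < j, t i = x
  neighbours : ∀ x : Fin m, 1 ≤ d.nat 6 x 0 ↔ (x : ℕ) = 0 ∨ ∃ i < j, T.Adj (t i) x
  covering : PartialCovering G.graph (NearTable R) bag t j fun v => d.nat 4 v 0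

namespace CoverState

variable {j : ℕ} {d d' : Memory} {t : ℕ → Fin m}

theorem adj_iff (h : CoverState G T bag ρ R j d t) (u v : Fin n) :
    1 ≤ d.nat 1 u v ↔ G.graph.Adj u v := by
  rw [h.input 1 (by norm_num), inputMemory_adj]
  split_ifs with h' <;> simp [h']

theorem tree_iff (h : CoverState G T bag ρ R j d t) (u v : Fin m) :
    1 ≤ d.nat 2 u v ↔ T.Adj u v := by
  rw [h.input 2 (by norm_num), inputMemory_tree]
  split_ifs with h' <;> simp [h']

theorem bag_iff (h : CoverState G T bag ρ R j d t) (x : Fin m) (v : Fin n) :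
    1 ≤ d.nat 3 x v ↔ v ∈ bag x := by
  rw [h.input 3 (by norm_num), inputMemory_bag]
  split_ifs with h' <;> simp [h']

/-- The vertices covered in a round with bag `B`, for given labels. -/
def covers (H : SimpleGraph (Fin n)) (near : Fin n → Fin n → Prop) (B : Finset (Fin n))
    (lab : Fin n → ℕ) : Set (Fin n) :=
  {w | ∃ c ∈ B, lab c = 0 ∧ ∃ p : H.Walk w c, ∀ z ∈ p.support,
    (∃ b ∈ B, near b z) ∧ lab z = 0}

/-- The set `covers` serves as `S` in `PartialCovering.step`. Reflexivity of nearness is what admits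
the unlabelled bag vertices as seeds. -/
theorem step (h : CoverState G T bag ρ R j d t) (hrefl : ∀ v : Fin n, NearTable R v v) (x : Fin m)
    (hx : d.nat 5 x 0 = 0) (hx' : 1 ≤ d.nat 6 x 0) (hinput : ∀ a < 4, d'.nat a = d.nat a)
    (hreal : d'.real = d.real) (hused : d'.nat 10 0 0 = d.nat 10 0 0 + n)
    (hfresh : ∀ y ≠ j, ∀ z, (1 ≤ d'.nat 8 y z ↔ 1 ≤ d.nat 8 y z) ∧
      (1 ≤ d'.nat 9 y z ↔ 1 ≤ d.nat 9 y z))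
    (hvisited : ∀ y : Fin m, 1 ≤ d'.nat 5 y 0 ↔ 1 ≤ d.nat 5 y 0 ∨ y = x)
    (hneighbours : ∀ y : Fin m, 1 ≤ d'.nat 6 y 0 ↔ 1 ≤ d.nat 6 y 0 ∨ T.Adj x y)
    (hnew : ∀ v ∈ covers G.graph (NearTable R) (bag x) (fun v => d.nat 4 v 0),
      ∃ b ∈ bag x, NearTable R b v ∧ d'.nat 4 v 0 = d.nat 10 0 0 + b + 1)
    (hold : ∀ v : Fin n, v ∉ covers G.graph (NearTable R) (bag x) (fun v => d.nat 4 v 0) →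
      d'.nat 4 v 0 = d.nat 4 v 0) :
    CoverState G T bag ρ R (j + 1) d' (Function.update t j x) := by
  have hlt : ∀ i < j, Function.update t j x i = t i := fun i hi =>
    Function.update_of_ne hi.ne _ _
  have hex : ∀ P : Fin m → Prop, (∃ i < j + 1, P (Function.update t j x i)) ↔
      (∃ i < j, P (t i)) ∨ P x := by
    intro P
    constructor
    · rintro ⟨i, hi, hP⟩
      rcases Nat.lt_succ_iff_lt_or_eq.1 hi with hi | rfl
      · exact Or.inl ⟨i, hi, hlt i hi ▸ hP⟩
      · rw [Function.update_self] at hP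
        exact Or.inr hP
    · rintro (⟨i, hi, hP⟩ | hP)
      · exact ⟨i, by omega, by rwa [hlt i hi]⟩
      · exact ⟨j, by omega, by rwa [Function.update_self]⟩
  refine ⟨fun a ha => (hinput a ha).trans (h.input a ha), hreal.trans h.real, ?_,
    fun y hy z => ?_, h.search.step (fun i hi hix => ?_) ((h.neighbours x).1 hx'), fun y => ?_,
    fun y => ?_, ?_⟩
  · rw [hused, h.used]; ring
  · rw [(hfresh y (by omega) z).1, (hfresh y (by omega) z).2]
    exact h.fresh y (by omega) z
  · have := (h.visited x).2 ⟨i, hi, hix⟩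
    omega
  · rw [hvisited, h.visited, hex (fun z => z = y), eq_comm (a := x)]
  · rw [hneighbours, h.neighbours, hex (fun z => T.Adj z y), or_assoc]
  · have hC := h.covering.congr hlt
    refine hC.step (covers G.graph (NearTable R) (bag x) fun v => d.nat 4 v 0) ?_ ?_ ?_ ?_ hold
    all_goals rw [Function.update_self]
    · intro v hv hv0
      exact ⟨v, hv, hv0, .nil, by simpa using ⟨⟨v, hv, hrefl v⟩, hv0⟩⟩
    · rintro v ⟨c, hc, hc0, p, hp⟩ w hvw hw0 hw
      refine ⟨c, hc, hc0, .cons hvw.symm p, fun z hz => ?_⟩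
      rw [SimpleGraph.Walk.support_cons, List.mem_cons] at hz
      rcases hz with rfl | hz
      · exact ⟨hw, hw0⟩
      · exact hp z hz
    · rintro v ⟨c, hc, hc0, p, hp⟩
      refine ⟨(hp v p.start_mem_support).2, c, hc, p.reverse, fun z hz => ?_⟩
      rw [SimpleGraph.Walk.support_reverse, List.mem_reverse] at hz
      -- Any vertex on a covering walk is itself covered, by the remainder of that walk.
      exact ⟨c, hc, hc0, p.dropUntil z hz, fun y hy =>
        hp y (p.support_dropUntil_subset_support hz hy)⟩
    · intro v hv
      rw [← h.used]
      exact hnew v hv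

end CoverState

/-- The step bound of `coverRoundProgram`. -/
def coverRoundTime (q : ℕ) : ℕ :=
  (q * 4 + 2) + (1 + ((q * 4 + 2) + ((q * (q * 4 + 2 + 2) + 2) + ((q * 4 + 2) +
    ((q * (q * (q * 4 + 2 + 2) + 2 + 2) + 2) + (q * (1 + (q * 4 + 2) + 2) + 2))))))

/-- Each stage leaves all arrays but its own untouched, so the stages can be read off one by one and
combined into the hypotheses of `CoverState.step`. -/
theorem coverRoundProgram_runs {q j : ℕ} (hnq : n ≤ q) (hmq : m ≤ q) (hT : T.Connected)
    (hrefl : ∀ v : Fin n, NearTable R v v) (hj : j < m) {s : Memory} (hsj : s.nat 100 0 0 = j)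
    {t : ℕ → Fin m} (h : CoverState G T bag ρ R j s.data t) :
    Runs 101 coverRoundProgram s (coverRoundTime q)
      fun d => ∃ t', CoverState G T bag ρ R (j + 1) d t' := by
  have hn : s.data.nat 0 0 0 = n := by rw [h.input 0 (by norm_num)]; rfl
  have hm : s.data.nat 0 0 1 = m := by rw [h.input 0 (by norm_num)]; rfl
  have hex : ∃ x < m, s.data.nat 5 x 0 = 0 ∧ 1 ≤ s.data.nat 6 x 0 := by
    obtain ⟨x, hx, hx'⟩ := h.search.exists_next hT hj
    refine ⟨x, x.2, ?_, (h.neighbours x).2 hx'⟩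
    have := mt (h.visited x).1 (by push Not; exact hx)
    omega
  refine Runs.seq (selectProgram_runs hmq hm hex) fun s₁ c₁ ⟨e₁, hx₁, hx5, hx6⟩ => ?_
  obtain ⟨x, hx⟩ : ∃ x : Fin m, s₁.data.nat 7 0 0 = x := ⟨⟨_, hx₁⟩, rfl⟩
  rw [hx] at hx5 hx6
  have hsel : selected.eval s₁ = x := by
    rw [← hx, Memory.data_nat _ (by norm_num)]; rfl
  refine Runs.seq (T := 1) (Q := fun d => SameExcept 5 s₁.data d ∧
    ∀ y, d.nat 5 y 0 = if y = x then 1 else s₁.data.nat 5 y 0) (Runs.setNat (by norm_num)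
      ⟨SameExcept.update _ _ _ _ _, fun y => by
        simp [updateCell_same, hsel, zeroExpr, NatExpr.eval]⟩) fun s₂ c₂ ⟨e₂, hv₂⟩ => ?_
  refine Runs.seq (neighbourProgram_flags hmq (by simp [e₁.1, e₂.1, hm]))
    fun s₃ c₃ ⟨e₃, hf₃⟩ => ?_
  have hj₃ : s₃.nat 100 0 0 = j := by simp [c₃, c₂, c₁, hsj]
  refine Runs.seq (ballProgram_flags hnq (by simp [e₁.1, e₂.1, e₃.1, hn]) hj₃)
    fun s₄ c₄ ⟨e₄, hf₄⟩ => ?_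
  have hj₄ : s₄.nat 100 0 0 = j := by simp [c₄, hj₃]
  refine Runs.seq (seedProgram_flags hnq (by simp [e₁.1, e₂.1, e₃.1, e₄.1, hn]) hj₄)
    fun s₅ c₅ ⟨e₅, hf₅⟩ => ?_
  have hj₅ : s₅.nat 100 0 0 = j := by simp [c₅, hj₄]
  have hbag : ∀ b : Fin n, 1 ≤ s.data.nat 3 x b ↔ b ∈ bag x := fun b => h.bag_iff x b
  have hball : ∀ v : Fin n, 1 ≤ s₄.data.nat 8 j v ↔ ∃ b ∈ bag x, NearTable R b v := by
    intro v
    rw [hf₄]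
    simp only [e₃.1, e₂.1, e₁.1, e₃.2, e₂.2, e₁.2, hx, h.real, ne_eq,
      Nat.reduceEqDiff, not_false_eq_true, (h.fresh j le_rfl v).1, false_or, true_and]
    constructor
    · rintro ⟨b, hb, v', -, ⟨h1, h2⟩, rfl⟩
      exact ⟨⟨b, hb⟩, (hbag ⟨b, hb⟩).1 h1, h2⟩
    · rintro ⟨b, hb, h2⟩
      exact ⟨b, b.2, v, v.2, ⟨(hbag b).2 hb, h2⟩, rfl⟩
  have hseed : ∀ v : Fin n, 1 ≤ s₅.data.nat 9 j v ↔ v ∈ bag x ∧ s.data.nat 4 v 0 = 0 := by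
    intro v
    rw [hf₅]
    simp only [e₄.1, e₃.1, e₂.1, e₁.1, hx, ne_eq, Nat.reduceEqDiff,
      not_false_eq_true, (h.fresh j le_rfl v).2, false_or, true_and]
    constructor
    · rintro ⟨v', -, ⟨h1, h2⟩, rfl⟩
      exact ⟨(hbag v).1 h1, h2⟩
    · rintro ⟨h1, h2⟩
      exact ⟨v, v.2, ⟨(hbag v).2 h1, h2⟩, rfl⟩
  have hallowed : ∀ v : Fin n, Allowed s₅.data j v ↔
      (∃ b ∈ bag x, NearTable R b v) ∧ s.data.nat 4 v 0 = 0 := by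
    intro v
    rw [Allowed, ← hball]
    simp [e₅.1, e₄.1, e₃.1, e₂.1, e₁.1]
  refine Runs.seq (closeProgram_runs (H := G.graph) hnq hj₅
    (by simp [e₁.1, e₂.1, e₃.1, e₄.1, e₅.1, hn])
    (fun u v => by
      rw [← h.adj_iff u v]
      simp [e₁.1, e₂.1, e₃.1, e₄.1, e₅.1])
    (fun v hv => (hallowed v).2 ⟨⟨v, ((hseed v).1 hv).1, hrefl v⟩, ((hseed v).1 hv).2⟩))
    fun s₆ c₆ ⟨e₆, hr₆, hf₆⟩ => ?_
  have hj₆ : s₆.nat 100 0 0 = j := by simp [c₆, hj₅]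
  have hcovers : ∀ v : Fin n, 1 ≤ s₆.data.nat 9 j v ↔
      v ∈ CoverState.covers G.graph (NearTable R) (bag x) (fun v => s.data.nat 4 v 0) := by
    intro v
    simp only [hf₆, ReachableFromMarked, hseed, hallowed, and_assoc]
    rfl
  refine (labelProgram_runs hnq hj₆ (by simp [e₁.1, e₂.1, e₃.1, e₄.1, e₅.1, e₆.1, hn])).mono le_rfl
    fun d ⟨⟨e₇, e₇'⟩, hu, hl⟩ => ⟨Function.update t j x, ?_⟩
  have hnear : ∀ b v : Fin n, NearSelected s₆.data b v ↔ b ∈ bag x ∧ NearTable R b v := by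
    intro b v
    rw [← hbag b, NearSelected, NearTable]
    simp [e₁.1, e₂.1, e₃.1, e₄.1, e₅.1, e₆.1, e₁.2, e₂.2, e₃.2, e₄.2, e₅.2, e₆.2, hx, h.real,
      -Memory.data_real]
  have hlab₆ : s₆.data.nat 4 = s.data.nat 4 := by
    simp [e₁.1, e₂.1, e₃.1, e₄.1, e₅.1, e₆.1]
  have hused₆ : s₆.data.nat 10 = s.data.nat 10 := by
    simp [e₁.1, e₂.1, e₃.1, e₄.1, e₅.1, e₆.1]
  refine h.step hrefl x hx5 hx6 (fun a ha => ?_) ?_ (by rw [hu, hused₆]) (fun y hy z => ⟨?_, ?_⟩)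
    (fun y => ?_) (fun y => ?_) (fun v hv => ?_) fun v hv => ?_
  · rw [e₇ a (by omega) (by omega), e₆.1 a (by omega), e₅.1 a (by omega), e₄.1 a (by omega),
      e₃.1 a (by omega), e₂.1 a (by omega), e₁.1 a (by omega)]
  · rw [e₇', e₆.2, e₅.2, e₄.2, e₃.2, e₂.2, e₁.2]
  · rw [e₇ 8 (by norm_num) (by norm_num), e₆.1 8 (by norm_num), e₅.1 8 (by norm_num), hf₄,
      e₃.1 8 (by norm_num), e₂.1 8 (by norm_num), e₁.1 8 (by norm_num)]
    simp [hy]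
  · rw [e₇ 9 (by norm_num) (by norm_num), hr₆ y hy, hf₅, e₄.1 9 (by norm_num),
      e₃.1 9 (by norm_num), e₂.1 9 (by norm_num), e₁.1 9 (by norm_num)]
    simp [hy]
  · rw [e₇ 5 (by norm_num) (by norm_num), e₆.1 5 (by norm_num), e₅.1 5 (by norm_num),
      e₄.1 5 (by norm_num), e₃.1 5 (by norm_num), hv₂, e₁.1 5 (by norm_num)]
    by_cases hyx : y = x
    · simp [hyx]
    · simp [hyx, Fin.val_inj]
  · rw [e₇ 6 (by norm_num) (by norm_num), e₆.1 6 (by norm_num), e₅.1 6 (by norm_num),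
      e₄.1 6 (by norm_num), hf₃, ← h.tree_iff]
    simp only [e₂.1, e₁.1, hx, ne_eq, Nat.reduceEqDiff, not_false_eq_true,
      and_true]
    refine or_congr_right ⟨?_, fun h' => ⟨y, y.2, h', rfl⟩⟩
    rintro ⟨i, -, h', rfl⟩
    exact h'
  · obtain ⟨c, -, -, p, hp⟩ := id hv
    obtain ⟨⟨b, hb, hbv⟩, hv0⟩ := hp v p.start_mem_support
    have hpend : IsPending s₆.data j v :=
      ⟨(hcovers v).2 hv, by rw [hlab₆]; exact hv0⟩
    rcases hl v v.2 with ⟨-, hno⟩ | ⟨-, b', hb', hbv', hlab⟩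
    · exact absurd ⟨hpend, b, b.2, (hnear b v).2 ⟨hb, hbv⟩⟩ hno
    · obtain ⟨h1, h2⟩ := (hnear ⟨b', hb'⟩ v).1 hbv'
      exact ⟨⟨b', hb'⟩, h1, h2, by rw [hlab, hused₆]⟩
  · rcases hl v v.2 with ⟨hlab, -⟩ | ⟨hpend, -⟩
    · rw [hlab, hlab₆]
    · exact absurd ((hcovers v).1 hpend.1) hv

end Cover


/-! ### The complete program -/

section Main

variable {n m : ℕ} {G : EdgeWeightedGraph (Fin n)} {T : SimpleGraph (Fin m)}
  {bag : Fin m → Finset (Fin n)} {ρ : ℝ}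

theorem nearTable_of_length_le {d : Memory} (hd : d.real 1 0 0 = ρ)
    (hD : ∀ (i j : Fin n) (p : G.graph.Walk i j), d.real 2 i j ≤ G.length p) {u v : Fin n}
    (p : G.graph.Walk u v) (hp : (G.length p : ℝ) ≤ ρ / 2) : NearTable d.real u v := by
  have := hD u v p
  rw [NearTable, hd]
  linarith

theorem dist_le_of_nearTable {d : Memory} (hρ : 0 < ρ) (hd : d.real 1 0 0 = ρ)
    (hD : DistSound G ρ d) {b u v : Fin n} (hu : NearTable d.real b u)
    (hv : NearTable d.real b v) : G.dist u v ≤ ENNReal.ofReal ρ := by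
  rw [NearTable, hd] at hu hv
  -- An entry of at least `ρ` fails the test, as twice the entry would exceed `ρ > 0`; so the entry
  -- bounds the length of an actual walk.
  obtain ⟨p, hp⟩ := (hD b u).2.resolve_left (by linarith)
  obtain ⟨p', hp'⟩ := (hD b v).2.resolve_left (by linarith)
  refine (iInf_le _ (p.reverse.append p')).trans ?_
  rw [← ENNReal.ofReal_coe_nnreal]
  refine ENNReal.ofReal_le_ofReal ?_
  have : G.length (p.reverse.append p') = G.length p + G.length p' := by
    simp [EdgeWeightedGraph.length]
  rw [this, NNReal.coe_add]
  linarith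

/-- All working arrays start at `0`; the one cell that is set makes node `0` the first candidate of
the search. -/
theorem KeepsInput.coverState {s : Memory} (hs : KeepsInput (inputMemory G T bag ρ) s)
    (t : ℕ → Fin m) :
    CoverState G T bag ρ s.real 0 { s with nat := updateCell s.nat 6 0 0 1 } t := by
  have hzero : ∀ a, 4 ≤ a → a ≠ 6 → ∀ i j, updateCell s.nat 6 0 0 1 a i j = 0 := by
    intro a ha h6 i j
    rw [updateCell, if_neg (by simp [h6]), hs.1, inputMemory_nat_zero _ _ _ _ ha]
  refine ⟨fun a ha => ?_, rfl, ?_, fun y _ z => ?_, .zero t, fun x => ?_, fun x => ?_, ?_⟩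
  · rw [← hs.1]
    funext i j
    exact if_neg fun h => absurd h.1 (by omega)
  · simp [hzero 10]
  · simp [hzero 8, hzero 9]
  · simp [hzero 5]
  · simp only [updateCell, hs.1, inputMemory_nat_zero _ _ _ _ (show 4 ≤ 6 by norm_num)]
    split_ifs with h <;> simpa using h
  · simp only [hzero 4 le_rfl (by norm_num)]
    exact .zero t

/-- The step bound of `coverProgram`. -/
def coverTime (q : ℕ) : ℕ := 1 + (q * (coverRoundTime q + 2) + 2)

theorem coverProgram_runs {q : ℕ} (hnq : n ≤ q) (hmq : m ≤ q) (hT : T.Connected) {s : Memory}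
    (hs : KeepsInput (inputMemory G T bag ρ) s.data)
    (hrefl : ∀ v : Fin n, NearTable s.data.real v v) :
    Runs 100 coverProgram s (coverTime q)
      fun d => ∃ t, CoverState G T bag ρ s.data.real m d t := by
  obtain ⟨x⟩ := hT.nonempty
  refine Runs.seq (Runs.setNat (Q := fun d => ∃ t, CoverState G T bag ρ s.data.real 0 d t)
    (by norm_num) ⟨fun _ => x, ?_⟩) fun s₁ _ hs₁ => ?_
  · exact hs.coverState _
  · refine Runs.forLoop (K := m) (I := fun j d => ∃ t, CoverState G T bag ρ s.data.real j d t)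
      le_rfl hmq (fun j d ⟨t, h⟩ => ?_) hs₁ fun j hj s₂ _ hc ⟨t, h⟩ =>
        coverRoundProgram_runs hnq hmq hT hrefl hj hc h
    rw [h.input 0 (by norm_num)]
    rfl

open Polynomial in
/-- A polynomial that bounds the number of steps. -/
def timePolynomial : Polynomial ℕ :=
  let roundTime : Polynomial ℕ := (X * 4 + 2) + (1 + ((X * 4 + 2) + ((X * (X * 4 + 2 + 2) + 2) +
    ((X * 4 + 2) + ((X * (X * (X * 4 + 2 + 2) + 2 + 2) + 2) +
      (X * (1 + (X * 4 + 2) + 2) + 2))))))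
  ((X * (X * 5 + 2 + 2) + 2) + (X * (X * (X * (X * 4 + 2 + 2) + 2 + 2) + 2 + 2) + 2)) +
    (1 + (X * (roundTime + 2) + 2))

theorem timePolynomial_eval (q : ℕ) : timePolynomial.eval q = distTime q + coverTime q := by
  simp [timePolynomial, distTime, coverTime, coverRoundTime]

end Main

theorem theorem5 :
    ∃ (prog : Program) (time : Polynomial ℕ),
      ∀ (n m : ℕ) (G : EdgeWeightedGraph (Fin n)) (T : SimpleGraph (Fin m))
        (bag : Fin m → Finset (Fin n)) (ρ : ℝ),
        IsTreeDecomposition G.graph T bag → 0 < ρ →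
        ∃ (out : Memory) (steps : ℕ),
          Exec prog (inputMemory G T bag ρ) out steps ∧
          steps ≤ time.eval (n + m) ∧
          ∃ (P : Finpartition (Finset.univ : Finset (Fin n))) (le : P.parts → P.parts → Prop),
            IsLinearOrder P.parts le ∧
            Describes out P le ∧
            (∀ X ∈ P.parts, G.weakDiam (X : Set (Fin n)) ≤ ENNReal.ofReal ρ) ∧
            ∀ k : ℕ, (∀ t, (bag t).card ≤ k) → ∀ r : ℝ, ρ < r →
              G.wcol r P le ≤
                min (k * 2 ^ k * Nat.choose (k + ⌈2 * (r / ρ)⌉₊) k)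
                  ((2 * ⌈2 * r / ρ⌉₊ + k + 1) ^ (3 * ⌈2 * r / ρ⌉₊ + 4)) := by
  refine ⟨.seq distProgram coverProgram, timePolynomial, fun n m G T bag ρ hT hρ => ?_⟩
  -- Both step bounds are taken at `q = n + m`, which dominates the range of every loop.
  obtain ⟨s, t₁, hex₁, ht₁, -, hk, hD, hD'⟩ := distProgram_runs (G := G) (T := T) (bag := bag)
    (Nat.le_add_right n m) hρ
  have hd : s.data.real 1 0 0 = ρ := by rw [hk.2 1 (by norm_num)]; rfl
  obtain ⟨out, t₂, hex₂, ht₂, -, t, hC⟩ := coverProgram_runs (Nat.le_add_right n m)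
    (Nat.le_add_left m n) hT.tree.connected hk
    fun v => nearTable_of_length_le hd hD' .nil
      (by simpa [EdgeWeightedGraph.length] using (half_pos hρ).le)
  refine ⟨out, t₁ + t₂, hex₁.seq hex₂, by rw [timePolynomial_eval]; exact add_le_add ht₁ ht₂, ?_⟩
  obtain ⟨P, le, h1, h2, h⟩ := hC.covering.exists_partition hρ hT hC.search
    (fun u v p hp => nearTable_of_length_le hd hD' p hp)
    fun b u v hu hv => dist_le_of_nearTable hρ hd hD hu hv
  refine ⟨P, le, h1, fun X Y u hu v hv => ?_, h⟩
  rw [h2 X Y u hu v hv, Memory.data_nat out (by norm_num)]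

end
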